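/- Let $\mathbb F_q$ be a finite field with $q$ elements, $A=\mathbb F_q[\theta]$, $k=\mathbb F_q(\theta)$, $v$ a finite place of $k$, $\mathbb C_v$ the completion of an algebraic closure of $k_v$ with its $v$-adic absolute value, and $\overline k$ the algebraic closure of $k$ in $\mathbb C_v$. Put $L_i=\prod_{j=1}^{i}(\theta-\theta^{q^j})$. *The $t$-module.* For $r\ge 1$, $\mathfrak s=(s_1,\dots,s_r)$ with integers $s_i\ge 1$, and $\mathbf u=(u_1,\dots,u_r)\in\mathbb C_v^r$, put $d_\ell=s_\ell+\cdots+s_r$ and $d=d_1+\cdots+d_r$. Let $\rho:\mathbb F_q[t]\to \mathrm{Mat}_d(\mathbb C_v[\tau])$ (where $\tau\alpha=\alpha^q\tau$) be the $\mathbb F_q$-algebra homomorphism with $\rho_t=\theta I_d+N+E\tau$, where $N$ is block diagonal with blocks the $d_\ell\times d_\ell$ nilpotent matrices with ones on the first superdiagonal, and $E$ is block upper triangular, the only nonzero entry of its $d_\ell\times d_m$ block $E[\ell m]$ ($\ell\le m$) being $(-1)^{m-\ell}\prod_{e=\ell}^{m-1}u_e$ in the lower left corner. This defines the $t$-module $G_{\mathfrak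 s,\mathbf u}$. Let $\exp_G$ be the unique series $I_d+\sum_{i\ge1}Q_i\tau^i$ with $\exp_G\circ\,\partial\rho_a=\rho_a\circ\exp_G$ for all $a\in\mathbb F_q[t]$, where $\partial$ takes the coefficient of $\tau^0$, and let $\log_G$ be its formal inverse. Let $\mathbf v_{\mathfrak s,\mathbf u}$ be the point whose $\ell$-th block ($d_\ell$ coordinates) is $(0,\dots,0,(-1)^{r-\ell}u_\ell\cdots u_r)^{\mathrm{tr}}$. *$v$-adic CMSPLs.* Suppose $|u_i|_v\le 1$ for all $i$. Write $\tilde{\mathfrak s}=(s_r,\dots,s_1)$, $\tilde{\mathbf u}=(u_r,\dots,u_1)$, $\tilde d_\ell=s_{r+1-\ell}+\cdots+s_1$. Call $a\in\mathbb F_q[t]$ admissible if $a\ne0$ and all coordinates of $\rho_a(\mathbf v_{\tilde{\mathfrak s},\tilde{\mathbf u}})$ (for $G=G_{\tilde{\mathfrak s},\tilde{\mathbf u}}$) have absolute value $<1$. Then $\mathrm{Li}^\star_{\mathfrak s}(\mathbf u)_v$ is defined as $\frac{(-1)^{r-1}}{a(\theta)}$ times the $\tilde d_1$-th coordinate of $\log_G(\rho_a(\mathbf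 v_{\tilde{\mathfrak s},\tilde{\mathbf u}}))$ for any admissible $a$ (such $a$ exist and the value does not depend on $a$). Put $\mathrm{Li}^\star_\varnothing=0$. For $1\le i\le r$ put $\mathfrak s_{(i)}=(s_1+\cdots+s_i,s_{i+1},\dots,s_r)$, and $\mathfrak s_{(r+1)}=\varnothing$. **Theorem.** Let $r\ge1$, $\mathfrak s\in\mathbb Z_{\ge1}^r$ and $\mathbf u\in(\overline k^\times)^r$ with $|u_i|_v\le1$ for all $i$. Let $a(t)\in\mathbb F_q[t]$ be nonzero such that all coordinates of $\rho_a(\mathbf v_{\tilde{\mathfrak s},\tilde{\mathbf u}})\in G_{\tilde{\mathfrak s},\tilde{\mathbf u}}$ have $v$-adic absolute value $<1$, and write $\rho_a(\mathbf v_{\tilde{\mathfrak s},\tilde{\mathbf u}})=(V_1,\dots,V_r)^{\mathrm{tr}}$, $V_m=(V_{m,1},\dots,V_{m,\tilde d_m})^{\mathrm{tr}}$. Then all $V_{m,j}$ lie in $\overline k$, and $$\mathrm{Li}^\star_{\mathfrak s}(\mathbf u)_v=\frac{(-1)^{r-1}}{a(\theta)}\sum_{m=1}^{r}\sum_{j=0}^{\tilde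 d_m-1}\sum_{\ell=0}^{j}(-1)^{j+\ell+m-1}\binom j\ell\theta^\ell\Big\{\mathrm{Li}^\star_{\mathfrak s_{(r+1-m)}}(\theta^{j-\ell}V_{m,\tilde d_m-j},u_{r+2-m},\dots,u_r)_v-\mathrm{Li}^\star_{\mathfrak s_{(r+2-m)}}(\theta^{j-\ell}V_{m,\tilde d_m-j}u_{r+2-m},u_{r+3-m},\dots,u_r)_v\Big\},$$ where for $m=1$ the second term in braces is $\mathrm{Li}^\star_\varnothing=0$. Moreover all arguments on the right lie in the convergent region: the first argument of each CMSPL there (of positive depth) has absolute value $<1$, the others have absolute value $\le1$, and the CMSPL is given by its convergent power series $$\mathrm{Li}^\star_{(s'_1,\dots,s'_n)}(z_1,\dots,z_n)_v=\sum_{i_1\ge\cdots\ge i_n\ge0}\frac{z_1^{q^{i_1}}\cdots z_n^{q^{i_n}}}{L_{i_1}^{s'_1}\cdots L_{i_n}^{s'_n}}.$$ -/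

import Mathlib

open Polynomial IsDedekindDomain

noncomputable section

/-! ## The field `ℂ_v` for a finite place `v` of `k = 𝔽_q(θ)` -/

namespace FunctionFieldPlace

variable {F : Type*} [Field F] [Fintype F] (v : HeightOneSpectrum F[X])

/-- `q_v`, the cardinality of the residue field `A / vA`, where `A = 𝔽_q[θ]`. -/
def residueCard : ℕ := Nat.card (F[X] ⧸ v.asIdeal)

instance finite_residue : Finite (F[X] ⧸ v.asIdeal) := by
  obtain ⟨g, hg⟩ := (IsPrincipalIdealRing.principal v.asIdeal).principal
  have hg0 : g ≠ 0 := by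
    rintro rfl
    exact v.ne_bot (by simpa using hg)
  have hg' : v.asIdeal = Ideal.span {g} := hg
  have hfin : Module.Finite F (AdjoinRoot g) := (AdjoinRoot.powerBasis hg0).finite
  have hfin' : Finite (AdjoinRoot g) := Module.finite_of_finite F
  exact Finite.of_equiv (AdjoinRoot g) (Ideal.quotEquivOfEq hg'.symm).toEquiv

theorem one_lt_residueCard : (1 : NNReal) < (residueCard v : NNReal) := by
  have : Nontrivial (F[X] ⧸ v.asIdeal) := Ideal.Quotient.nontrivial_iff.mpr v.isPrime.ne_top
  exact_mod_cast Finite.one_lt_card (α := F[X] ⧸ v.asIdeal)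

/-- `k_v`, the completion of `k = 𝔽_q(θ)` at `v`. -/
abbrev Kv := v.adicCompletion (RatFunc F)

/-- The absolute value on `k_v` is normalized so that a uniformizer has norm `q_v⁻¹`. -/
instance rankOneKv : (Valued.v : Valuation (Kv v) (WithZero (Multiplicative ℤ))).RankOne :=
  Valuation.IsRankOneDiscrete.rankOne _ (one_lt_residueCard v)

instance nontriviallyNormedFieldKv : NontriviallyNormedField (Kv v) :=
  Valued.toNontriviallyNormedField (Kv v) (WithZero (Multiplicative ℤ))

instance isUltrametricDistKv : IsUltrametricDist (Kv v) :=
  IsUltrametricDist.isUltrametricDist_of_isNonarchimedean_norm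
    (Valued.isNonarchimedean_norm (Kv v) (WithZero (Multiplicative ℤ)))

/-- An algebraic closure of `k_v`. -/
abbrev KvBar := AlgebraicClosure (Kv v)

/-- The unique extension of the absolute value of `k_v` to its algebraic closure. -/
instance normedFieldKvBar : NormedField (KvBar v) := spectralNorm.normedField (Kv v) (KvBar v)

/-- `ℂ_v`, the completion of an algebraic closure of `k_v`. -/
def Cv := UniformSpace.Completion (KvBar v)

instance normedFieldCv : NormedField (Cv v) :=
  inferInstanceAs (NormedField (UniformSpace.Completion (KvBar v)))

instance completeSpaceCv : CompleteSpace (Cv v) :=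
  inferInstanceAs (CompleteSpace (UniformSpace.Completion (KvBar v)))

/-- The inclusion of `k` in `ℂ_v`, through `k_v` and its algebraic closure. -/
def kToCv : RatFunc F →+* Cv v :=
  (UniformSpace.Completion.coeRingHom (α := KvBar v)).comp
    ((algebraMap (Kv v) (KvBar v)).comp (algebraMap (RatFunc F) (Kv v)))

instance algebraRatFuncCv : Algebra (RatFunc F) (Cv v) := (kToCv v).toAlgebra

instance algebraConstCv : Algebra F (Cv v) :=
  ((algebraMap (RatFunc F) (Cv v)).comp (algebraMap F (RatFunc F))).toAlgebra

/-- The element `θ` of `ℂ_v`. -/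
def theta : Cv v := algebraMap (RatFunc F) (Cv v) RatFunc.X

end FunctionFieldPlace

/-! ## The rings `Mat_d(K)[τ] ⊆ Mat_d(K)[[τ]]` with `τ α = α^q τ` -/

section Twisted

variable (F : Type*) [Field F] [Fintype F] (K : Type*) [Field K] [Algebra F K]
  (ι : Type*) [Fintype ι] [DecidableEq ι]

/-- Entrywise `q ^ i`-th power `M ↦ M^(i)` of matrices, `q = #F`. -/
def twistMat (i : ℕ) : Matrix ι ι K →ₐ[F] Matrix ι ι K :=
  (FiniteField.frobeniusAlgHom F K ^ i).mapMatrix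

variable {F K ι} in
theorem twistMat_apply (i : ℕ) (M : Matrix ι ι K) :
    twistMat F K ι i M = M.map (fun x => x ^ (Fintype.card F) ^ i) := by
  ext a b
  simp [twistMat, AlgHom.coe_pow, FiniteField.coe_frobeniusAlgHom, pow_iterate]

variable {F K ι} in
theorem twistMat_twistMat (i j : ℕ) (M : Matrix ι ι K) :
    twistMat F K ι i (twistMat F K ι j M) = twistMat F K ι (i + j) M := by
  ext a b
  simp [twistMat_apply, ← pow_mul, pow_add, mul_comm]

variable {F K ι} in
theorem twistMat_zero (M : Matrix ι ι K) : twistMat F K ι 0 M = M := by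
  ext a b
  simp [twistMat_apply]

/-- Formal series `∑ i, f i τ ^ i` with matrix coefficients. The polynomials in `τ`, that is
`Mat_d(K[τ])`, are the series with finitely many nonzero coefficients. -/
@[nolint unusedArguments]
def TwistedSeries (_F : Type*) (K : Type*) (ι : Type*) := ℕ → Matrix ι ι K

namespace TwistedSeries

variable {F K ι}

instance : AddCommGroup (TwistedSeries F K ι) := inferInstanceAs (AddCommGroup (ℕ → Matrix ι ι K))

@[ext] theorem ext {f g : TwistedSeries F K ι} (h : ∀ n, f n = g n) : f = g := funext h

/-- `(α τ ^ i) (β τ ^ j) = α β^(i) τ ^ (i + j)`. -/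
instance : Mul (TwistedSeries F K ι) :=
  ⟨fun f g n => ∑ p ∈ Finset.HasAntidiagonal.antidiagonal n, f p.1 * twistMat F K ι p.1 (g p.2)⟩

variable (F) in
/-- The constant series `M τ ^ 0`. -/
def const (M : Matrix ι ι K) : TwistedSeries F K ι := fun n => if n = 0 then M else 0

instance : One (TwistedSeries F K ι) := ⟨const F 1⟩

theorem zero_apply (n : ℕ) : (0 : TwistedSeries F K ι) n = 0 := rfl

theorem add_apply (f g : TwistedSeries F K ι) (n : ℕ) : (f + g) n = f n + g n := rfl

theorem one_apply (n : ℕ) : (1 : TwistedSeries F K ι) n = if n = 0 then 1 else 0 := rfl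

theorem mul_apply (f g : TwistedSeries F K ι) (n : ℕ) :
    (f * g) n = ∑ p ∈ Finset.HasAntidiagonal.antidiagonal n, f p.1 * twistMat F K ι p.1 (g p.2) := rfl

theorem const_apply (M : Matrix ι ι K) (n : ℕ) : const F M n = if n = 0 then M else 0 := rfl

theorem const_mul_apply (M : Matrix ι ι K) (f : TwistedSeries F K ι) (n : ℕ) :
    (const F M * f) n = M * f n := by
  rw [mul_apply, Finset.sum_eq_single (0, n)]
  · simp [const_apply, twistMat_zero]
  · rintro ⟨i, j⟩ hp hne
    have : i ≠ 0 := by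
      rintro rfl
      simp at hp
      simp [hp] at hne
    simp [const_apply, this]
  · simp

theorem mul_const_apply (M : Matrix ι ι K) (f : TwistedSeries F K ι) (n : ℕ) :
    (f * const F M) n = f n * twistMat F K ι n M := by
  rw [mul_apply, Finset.sum_eq_single (n, 0)]
  · simp [const_apply]
  · rintro ⟨i, j⟩ hp hne
    have : j ≠ 0 := by
      rintro rfl
      simp at hp
      simp [hp] at hne
    simp [const_apply, this]
  · simp

instance : Ring (TwistedSeries F K ι) where
  __ := (inferInstance : AddCommGroup (TwistedSeries F K ι))
  mul_assoc f g h := by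
    ext1 n
    simp only [mul_apply, map_sum, map_mul, Finset.sum_mul, Finset.mul_sum, twistMat_twistMat]
    simp only [Finset.sum_sigma']
    apply Finset.sum_nbij' (fun ⟨⟨_i, j⟩, ⟨k, l⟩⟩ ↦ ⟨(k, l + j), (l, j)⟩)
      (fun ⟨⟨i, _j⟩, ⟨k, l⟩⟩ ↦ ⟨(i + k, l), (i, k)⟩) <;>
      grind [mul_assoc, Finset.HasAntidiagonal.mem_antidiagonal]
  one_mul f := by
    ext1 n
    exact (const_mul_apply (F := F) 1 f n).trans (by simp)
  mul_one f := by
    ext1 n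
    exact (mul_const_apply (F := F) 1 f n).trans (by simp)
  left_distrib f g h := by
    ext1 n
    simp [mul_apply, add_apply, mul_add, Finset.sum_add_distrib]
  right_distrib f g h := by
    ext1 n
    simp [mul_apply, add_apply, add_mul, Finset.sum_add_distrib]
  zero_mul f := by
    ext1 n
    simp [mul_apply, zero_apply]
  mul_zero f := by
    ext1 n
    simp [mul_apply, zero_apply]

/-- Constant series form a copy of the matrix ring. -/
def constRingHom : Matrix ι ι K →+* TwistedSeries F K ι where
  toFun := const F
  map_one' := rfl
  map_mul' M M' := by
    ext1 n
    rw [const_mul_apply]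
    by_cases h : n = 0 <;> simp [const_apply, h]
  map_zero' := by
    ext1 n
    simp [const_apply, zero_apply]
  map_add' M M' := by
    ext1 n
    by_cases h : n = 0 <;> simp [const_apply, add_apply, h]

/-- The `q`-Frobenius fixes `F`, so that the series form an `F`-algebra. -/
instance : Algebra F (TwistedSeries F K ι) :=
  (constRingHom.comp (algebraMap F (Matrix ι ι K))).toAlgebra' (by
    intro c f
    ext1 n
    have h1 := const_mul_apply (F := F) (algebraMap F (Matrix ι ι K) c) f n
    have h2 := mul_const_apply (F := F) (algebraMap F (Matrix ι ι K) c) f n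
    rw [AlgHom.commutes] at h2
    exact h1.trans ((Algebra.commutes c (f n)).trans h2.symm))

/-- The value of `∑ i, f i τ ^ i` at a point `x` of `K ^ d`: the coordinatewise limit of
`∑ i, f i * x^(i)`. The sum is finite when `f` is a polynomial in `τ`. -/
def eval [TopologicalSpace K] (f : TwistedSeries F K ι) (x : ι → K) : ι → K :=
  fun b => ∑' n : ℕ, (f n).mulVec (fun c => x c ^ (Fintype.card F) ^ n) b

/-- The defining property of `exp_G` for the `t`-module given by `ρ`: it has constant term `1`, and
`exp_G ∘ ∂ρ_a = ρ_a ∘ exp_G` for all `a`. -/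
def IsExp (ρ : F[X] →ₐ[F] TwistedSeries F K ι) (f : TwistedSeries F K ι) : Prop :=
  f 0 = 1 ∧ ∀ a : F[X], f * const F (ρ a 0) = ρ a * f

/-- The exponential of the `t`-module given by `ρ`. -/
def exp (ρ : F[X] →ₐ[F] TwistedSeries F K ι) : TwistedSeries F K ι :=
  Classical.epsilon (IsExp ρ)

/-- The logarithm of the `t`-module given by `ρ`: the formal inverse of the exponential. -/
def log (ρ : F[X] →ₐ[F] TwistedSeries F K ι) : TwistedSeries F K ι :=
  Ring.inverse (exp ρ)

end TwistedSeries

end Twisted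

/-! ## The `t`-module `G_{s,u}` and its special point

Blocks are numbered `0, …, r - 1` and the entries of a block from `0`. -/

namespace CMSPL

section TModule

variable {r : ℕ} (s : Fin r → ℕ)

/-- `d_ℓ = s_ℓ + ⋯ + s_r`. -/
def blockDim (ℓ : Fin r) : ℕ := ∑ e ∈ Finset.Ici ℓ, s e

/-- Coordinates of `𝔾_a ^ d`, `d = d_1 + ⋯ + d_r`: a block and a position in it. -/
abbrev Idx := Σ ℓ : Fin r, Fin (blockDim s ℓ)

variable (F : Type*) [Field F] [Fintype F] {K : Type*} [Field K] [Algebra F K]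
  (θ : K) (u : Fin r → K)

/-- The block diagonal nilpotent matrix `N`. -/
def matN : Matrix (Idx s) (Idx s) K := fun x y =>
  if x.1 = y.1 ∧ (y.2 : ℕ) = x.2 + 1 then 1 else 0

/-- The block upper triangular matrix `E`. The block `E[ℓ m]`, `ℓ ≤ m`, has its only nonzero
entry in the lower left corner. -/
def matE : Matrix (Idx s) (Idx s) K := fun x y =>
  if x.1 ≤ y.1 ∧ (x.2 : ℕ) + 1 = blockDim s x.1 ∧ (y.2 : ℕ) = 0 then
    (-1) ^ ((y.1 : ℕ) - (x.1 : ℕ)) * ∏ e ∈ Finset.Ico x.1 y.1, u e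
  else 0

/-- `ρ_t = θ I_d + N + E τ`. -/
def rhoT : TwistedSeries F K (Idx s) := fun n =>
  if n = 0 then Matrix.scalar (Idx s) θ + matN s else if n = 1 then matE s u else 0

/-- The `t`-module `G_{s,u}`, `a ↦ ρ_a`. -/
def rho : F[X] →ₐ[F] TwistedSeries F K (Idx s) := Polynomial.aeval (rhoT s F θ u)

/-- The special point: the last entry of the block `ℓ` is `(-1)^(r-ℓ) u_ℓ ⋯ u_r`
(for `ℓ = 1, …, r`), the other entries are `0`. -/
def specialPoint : Idx s → K := fun x =>
  if (x.2 : ℕ) + 1 = blockDim s x.1 then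
    (-1) ^ (r - 1 - (x.1 : ℕ)) * ∏ e ∈ Finset.Ici x.1, u e
  else 0

/-- The `d_1`-th coordinate, that is the last one of the first block (`0` if there is none). -/
def lastOfFirstBlock (x : Idx s → K) : K :=
  if h : ∃ hr : 0 < r, 0 < blockDim s ⟨0, hr⟩ then
    x ⟨⟨0, h.1⟩, ⟨blockDim s ⟨0, h.1⟩ - 1, Nat.sub_lt h.2 Nat.one_pos⟩⟩
  else 0

end TModule

/-! ## Carlitz multiple star polylogarithms -/

section Li

variable (F : Type*) [Field F] [Fintype F] {K : Type*} [NormedField K] [Algebra F K] (θ : K)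
  {r : ℕ} (s : Fin r → ℕ) (u : Fin r → K)

/-- The point `ρ_a(v_{s̃,ũ})` of the `t`-module `G_{s̃,ũ}`, where `s̃ = (s_r, …, s_1)` and
`ũ = (u_r, …, u_1)`. -/
def rhoPoint (a : F[X]) : Idx (s ∘ Fin.rev) → K :=
  (rho (s ∘ Fin.rev) F θ (u ∘ Fin.rev) a).eval (specialPoint (s ∘ Fin.rev) (u ∘ Fin.rev))

/-- `a ≠ 0` and all coordinates of `ρ_a(v_{s̃,ũ})` lie in the maximal ideal. -/
def IsAdmissible (a : F[X]) : Prop := a ≠ 0 ∧ ∀ x, ‖rhoPoint F θ s u a x‖ < 1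

open Classical in
/-- The (analytically continued) value `Li⋆_s(u)`: for any admissible `a`, it is
`(-1)^(r-1) / a(θ)` times the `d̃_1`-th coordinate of `log (ρ_a(v_{s̃,ũ}))`, where `log` is the
logarithm of `G_{s̃,ũ}`. In depth `r = 0` it is `0`. -/
def Li : K :=
  if h : ∃ a : F[X], IsAdmissible F θ s u a then
    (-1) ^ (r - 1) / Polynomial.aeval θ h.choose *
      lastOfFirstBlock (s ∘ Fin.rev)
        ((TwistedSeries.log (rho (s ∘ Fin.rev) F θ (u ∘ Fin.rev))).eval
          (rhoPoint F θ s u h.choose))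
  else 0

/-- `L_i = (θ - θ^q) ⋯ (θ - θ^(q^i))`. -/
def bigL (i : ℕ) : K := ∏ j ∈ Finset.Icc 1 i, (θ - θ ^ (Fintype.card F) ^ j)

/-- The terms of the power series
`∑_{i_1 ≥ ⋯ ≥ i_r ≥ 0} u_1^(q^i_1) ⋯ u_r^(q^i_r) / (L_{i_1}^{s_1} ⋯ L_{i_r}^{s_r})`. -/
def liTerm (i : {i : Fin r → ℕ // Antitone i}) : K :=
  ∏ n, u n ^ (Fintype.card F) ^ (i.1 n) / bigL F θ (i.1 n) ^ s n

end Li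

section Tuples

variable {r : ℕ}

/-- The entry of a tuple at the position `i`, counted from `1` (`0` out of range). -/
def entry {α : Type*} [Zero α] (x : Fin r → α) (i : ℕ) : α :=
  if h : 1 ≤ i ∧ i ≤ r then x ⟨i - 1, by omega⟩ else 0

/-- `s_(i) = (s_1 + ⋯ + s_i, s_{i+1}, …, s_r)` for `1 ≤ i ≤ r`; it is empty for `i > r`. -/
def merged (s : Fin r → ℕ) (i : ℕ) : Fin (r + 1 - i) → ℕ := fun n =>
  if (n : ℕ) = 0 then ∑ e ∈ Finset.Icc 1 i, entry s e else entry s (i + n)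

/-- `(z, u_{i+1}, …, u_r)` for `1 ≤ i ≤ r`; it is empty for `i > r`. -/
def withHead {K : Type*} [Zero K] (z : K) (u : Fin r → K) (i : ℕ) : Fin (r + 1 - i) → K :=
  fun n => if (n : ℕ) = 0 then z else entry u (i + n)

end Tuples

end CMSPL

end

/-!
Only the row of `log_G` that belongs to the last coordinate of the first block enters. Read in this
row, the functional equation `log_G ρ_t = ∂ρ_t log_G` is a recursion whose solution is explicit: the
`τ ^ k`-coefficient at the coordinate lying `j` places above the end of block `m` is, up to sign,
`(θ - θ ^ q ^ k) ^ j / L_k ^ d_m` times a nested sum over indices `< k`. Expanding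
`(θ - θ ^ q ^ k) ^ j` by the binomial theorem turns the coordinate `V` into the arguments
`θ ^ (j - l) V`, and writing a nested sum over indices `< k` as the sum over indices `≤ k` minus the
contribution of the index `k` produces the difference of two star polylogarithms.

Since `θ ^ q ^ n - θ` is squarefree, `|θ - θ ^ q ^ n|` is bounded below, so that `|L_k|⁻¹` grows at
most geometrically, whereas `|z| ^ q ^ k` decays doubly exponentially for `|z| < 1`. This gives
convergence on the open unit polydisc, where the functional equation holds for values as well and
makes `Li` independent of the admissible `a`.
-/

noncomputable section

open Filter Topology

theorem frobeniusAlgHom_pow_apply (F : Type*) [Field F] [Fintype F] {K : Type*} [CommRing K]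
    [Algebra F K] (n : ℕ) (x : K) :
    (FiniteField.frobeniusAlgHom F K ^ n) x = x ^ Fintype.card F ^ n := by
  simp [AlgHom.coe_pow, FiniteField.coe_frobeniusAlgHom, pow_iterate]

theorem neg_one_pow_pow_card_pow (F : Type*) [Field F] [Fintype F] {K : Type*} [CommRing K]
    [Algebra F K] (n k : ℕ) : ((-1 : K) ^ n) ^ Fintype.card F ^ k = (-1) ^ n := by
  rw [← frobeniusAlgHom_pow_apply F k, map_pow, map_neg, map_one]

theorem transcendental_of_pow_card_pow_ne {F K : Type*} [Field F] [Fintype F] [Field K]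
    [Algebra F K] {θ : K} (hθ : ∀ n ≠ 0, θ ^ Fintype.card F ^ n ≠ θ) : Transcendental F θ := by
  intro halg
  let L := IntermediateField.adjoin F {θ}
  have : FiniteDimensional F L := IntermediateField.adjoin.finiteDimensional halg.isIntegral
  have : Finite L := Module.finite_of_finite F
  have : Fintype L := Fintype.ofFinite L
  have h := FiniteField.pow_card (⟨θ, IntermediateField.mem_adjoin_simple_self F θ⟩ : L)
  rw [Module.card_eq_pow_finrank (K := F)] at h
  exact hθ _ Module.finrank_pos.ne' (congrArg Subtype.val h)

theorem exists_mul_add_eq_add_mul_add {K A : Type*} [Field K] [Ring A] [Algebra K A] {N N' : A}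
    (hN : IsNilpotent N) (hN' : IsNilpotent N') {a b : K} (hab : a ≠ b) (M : A) :
    ∃ X : A, X * (algebraMap K A a + N) = (algebraMap K A b + N') * X + M := by
  have hT : IsNilpotent (LinearMap.mulRight K N - LinearMap.mulLeft K N') :=
    (LinearMap.commute_mulLeft_right N' N).symm.isNilpotent_sub
      ((LinearMap.isNilpotent_mulRight_iff K N).mpr hN)
      ((LinearMap.isNilpotent_mulLeft_iff K N').mpr hN')
  have hab' : IsUnit (algebraMap K (Module.End K A) (a - b)) :=
    (IsUnit.mk0 _ (sub_ne_zero.mpr hab)).map _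
  have hunit := hT.isUnit_add_left_of_commute hab' (Algebra.commutes _ _).symm
  obtain ⟨X, hX⟩ := ((Module.End.isUnit_iff _).mp hunit).2 M
  have hX' : (a - b) • X + (X * N - N' * X) = M := hX
  refine ⟨X, ?_⟩
  rw [mul_add, add_mul, ← hX', ← Algebra.commutes, ← Algebra.smul_def, ← Algebra.smul_def, sub_smul]
  abel

theorem aeval_apply_mem {R M : Type*} [CommRing R] [AddCommGroup M] [Module R M]
    {φ : Module.End R M} {S : Submodule R M} (hφ : ∀ x ∈ S, φ x ∈ S) (a : R[X]) {x : M}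
    (hx : x ∈ S) : aeval φ a x ∈ S := by
  induction a using Polynomial.induction_on with
  | C c =>
    rw [aeval_C, Module.algebraMap_end_apply]
    exact S.smul_mem c hx
  | add a b ha hb =>
    rw [map_add]
    exact S.add_mem ha hb
  | monomial n c h =>
    rw [pow_succ', mul_left_comm, map_mul, aeval_X]
    exact hφ _ h

namespace TwistedSeries

section Points

variable {F : Type*} [Field F] [Fintype F] {K : Type*} [Field K] [Algebra F K] {ι : Type*}

variable (F) in
/-- The entrywise `q ^ n`-th power `x ↦ x^(n)` of vectors, `q = #F`. -/
def twistVec (n : ℕ) : (ι → K) →ₗ[F] (ι → K) :=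
  (FiniteField.frobeniusAlgHom F K ^ n).toLinearMap.compLeft ι

theorem twistVec_apply (n : ℕ) (x : ι → K) (c : ι) :
    twistVec F n x c = x c ^ Fintype.card F ^ n :=
  frobeniusAlgHom_pow_apply F n (x c)

theorem twistVec_twistVec (m n : ℕ) (x : ι → K) :
    twistVec F m (twistVec F n x) = twistVec F (m + n) x := by
  ext c
  simp only [twistVec_apply, ← pow_mul, ← pow_add, add_comm]

variable [Fintype ι]

variable (F) in
/-- The action `x ↦ A x + B x^(1)` of the series `A + B τ` on points. -/
def linearAction (A B : Matrix ι ι K) : Module.End F (ι → K) :=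
  A.mulVecLin.restrictScalars F + B.mulVecLin.restrictScalars F ∘ₗ twistVec F 1

theorem linearAction_apply (A B : Matrix ι ι K) (x : ι → K) :
    linearAction F A B x = A.mulVec x + B.mulVec (twistVec F 1 x) := rfl

theorem linearAction_apply_mem {A B : Matrix ι ι K} (S : Subalgebra F K) (hA : ∀ b c, A b c ∈ S)
    (hB : ∀ b c, B b c ∈ S) {x : ι → K} (hx : ∀ c, x c ∈ S) (b : ι) :
    linearAction F A B x b ∈ S := by
  refine add_mem (sum_mem fun c _ => mul_mem (hA b c) (hx c))
    (sum_mem fun c _ => mul_mem (hB b c) ?_)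
  rw [twistVec_apply]
  exact pow_mem (hx c) _

theorem aeval_linearAction_apply_mem {A B : Matrix ι ι K} (S : Subalgebra F K)
    (hA : ∀ b c, A b c ∈ S) (hB : ∀ b c, B b c ∈ S) (a : F[X]) {x : ι → K} (hx : ∀ c, x c ∈ S)
    (b : ι) : aeval (linearAction F A B) a x b ∈ S := by
  let T : Submodule F (ι → K) := Submodule.pi Set.univ fun _ => Subalgebra.toSubmodule S
  have hT (y : ι → K) : y ∈ T ↔ ∀ c, y c ∈ S := by simp [T, Submodule.mem_pi]
  refine (hT _).mp (aeval_apply_mem (fun y hy => (hT _).mpr ?_) a ((hT _).mpr hx)) b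
  exact linearAction_apply_mem S hA hB ((hT y).mp hy)

end Points

section Algebraic

variable {F : Type*} [Field F] [Fintype F] {K : Type*} [Field K] [Algebra F K]
  {ι : Type*} [Fintype ι] [DecidableEq ι]

theorem mul_apply_zero (f g : TwistedSeries F K ι) : (f * g) 0 = f 0 * g 0 := by
  rw [mul_apply, Finset.Nat.antidiagonal_zero, Finset.sum_singleton, twistMat_zero]

theorem mul_apply_succ (f g : TwistedSeries F K ι) (n : ℕ) :
    (f * g) (n + 1) = f 0 * g (n + 1) +
      ∑ i : Fin (n + 1), f (i + 1) * twistMat F K ι (i + 1) (g (n - i)) := by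
  rw [mul_apply, Finset.Nat.sum_antidiagonal_succ, twistMat_zero,
    Finset.Nat.sum_antidiagonal_eq_sum_range_succ_mk, Finset.sum_range]

/-- The series `f` with `f 0 = 1` whose coefficients are computed from those of `f * g` that
involve earlier coefficients only, the `n`-th step being solved by `S n`. -/
def ofSolver (g : TwistedSeries F K ι) (S : ℕ → Matrix ι ι K → Matrix ι ι K) : ℕ → Matrix ι ι K
  | 0 => 1
  | n + 1 => S n (∑ i : Fin (n + 1), g (i + 1) * twistMat F K ι (i + 1) (ofSolver g S (n - i)))

theorem exists_forall_mul_apply_succ (g : TwistedSeries F K ι)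
    {R : ℕ → Matrix ι ι K → Matrix ι ι K → Prop} (hR : ∀ n M, ∃ X, R n M X) :
    ∃ f : TwistedSeries F K ι,
      f 0 = 1 ∧ ∀ n, R n ((g * f) (n + 1) - g 0 * f (n + 1)) (f (n + 1)) := by
  choose S hS using hR
  let f : TwistedSeries F K ι := ofSolver g S
  refine ⟨f, ofSolver.eq_1 g S, fun n => ?_⟩
  rw [mul_apply_succ, add_sub_cancel_left, show f (n + 1) = _ from ofSolver.eq_2 g S n]
  exact hS n _

theorem exists_mul_eq_one {f : TwistedSeries F K ι} (hf : f 0 = 1) :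
    ∃ g : TwistedSeries F K ι, g 0 = 1 ∧ f * g = 1 := by
  obtain ⟨g, hg, hfg⟩ := exists_forall_mul_apply_succ f (R := fun _ M X => M = -X)
    fun _ M => ⟨-M, (neg_neg M).symm⟩
  refine ⟨g, hg, ?_⟩
  ext1 n
  cases n with
  | zero => rw [mul_apply_zero, hf, hg, one_mul, one_apply, if_pos rfl]
  | succ n =>
    have h := hfg n
    rw [hf, one_mul, sub_eq_neg_self] at h
    rw [h, one_apply, if_neg n.succ_ne_zero]

theorem isUnit_of_apply_zero {f : TwistedSeries F K ι} (hf : f 0 = 1) : IsUnit f := by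
  obtain ⟨g, hg, hfg⟩ := exists_mul_eq_one hf
  obtain ⟨h, -, hgh⟩ := exists_mul_eq_one hg
  exact ⟨⟨f, g, hfg, by rwa [left_inv_eq_right_inv hfg hgh]⟩, rfl⟩

theorem algebraMap_eq_const (c : F) :
    algebraMap F (TwistedSeries F K ι) c = const F (algebraMap F (Matrix ι ι K) c) := rfl

theorem const_add (M M' : Matrix ι ι K) :
    const F (M + M') = (const F M + const F M' : TwistedSeries F K ι) :=
  constRingHom.map_add M M'

theorem const_mul (M M' : Matrix ι ι K) :
    const F (M * M') = (const F M * const F M' : TwistedSeries F K ι) :=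
  constRingHom.map_mul M M'

theorem isExp_of_X {ρ : F[X] →ₐ[F] TwistedSeries F K ι} {f : TwistedSeries F K ι}
    (h0 : f 0 = 1) (hX : f * const F (ρ X 0) = ρ X * f) : IsExp ρ f := by
  refine ⟨h0, fun a => ?_⟩
  induction a using Polynomial.induction_on with
  | C c =>
    rw [← Polynomial.algebraMap_eq, AlgHom.commutes, algebraMap_eq_const, const_apply, if_pos rfl,
      ← algebraMap_eq_const]
    exact (Algebra.commutes c f).symm
  | add a b ha hb => rw [map_add, add_apply, const_add, mul_add, add_mul, ha, hb]
  | monomial n c h =>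
    rw [pow_succ, ← mul_assoc, map_mul, mul_apply_zero, const_mul, ← mul_assoc, h, mul_assoc, hX,
      mul_assoc]

theorem twistMat_scalar (n : ℕ) (a : K) :
    twistMat F K ι n (Matrix.scalar ι a) = Matrix.scalar ι (a ^ Fintype.card F ^ n) := by
  rw [twistMat_apply, Matrix.scalar_apply, Matrix.scalar_apply]
  exact Matrix.diagonal_map (f := fun x => x ^ Fintype.card F ^ n)
    (zero_pow (pow_ne_zero n Fintype.card_ne_zero))

/-- For nilpotent `N`, the functional equation for `t` determines the coefficients of the
exponential one after the other, since `θ` differs from its twists. -/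
theorem exists_isExp {ρ : F[X] →ₐ[F] TwistedSeries F K ι} {θ : K} {N : Matrix ι ι K}
    (hρ : ρ X 0 = Matrix.scalar ι θ + N) (hN : IsNilpotent N)
    (hθ : ∀ n ≠ 0, θ ^ Fintype.card F ^ n ≠ θ) : ∃ f, IsExp ρ f := by
  obtain ⟨f, hf, hsucc⟩ := exists_forall_mul_apply_succ (ρ X) fun n M =>
    exists_mul_add_eq_add_mul_add (hN.map (twistMat F K ι (n + 1))) hN (hθ (n + 1) n.succ_ne_zero) M
  refine ⟨f, isExp_of_X hf ?_⟩
  ext1 n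
  cases n with
  | zero => rw [mul_apply_zero, mul_apply_zero, hf, const_apply, if_pos rfl, one_mul, mul_one]
  | succ n =>
    have h : _ = (Matrix.scalar ι θ + N) * f (n + 1) + _ := hsucc n
    rw [hρ, add_sub_cancel] at h
    rw [mul_const_apply, hρ, map_add, twistMat_scalar]
    exact h

theorem log_spec {ρ : F[X] →ₐ[F] TwistedSeries F K ι} (h : ∃ f, IsExp ρ f) :
    log ρ 0 = 1 ∧ ∀ a, log ρ * ρ a = const F (ρ a 0) * log ρ := by
  have hexp : IsExp ρ (exp ρ) := Classical.epsilon_spec h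
  have hunit : IsUnit (exp ρ) := isUnit_of_apply_zero hexp.1
  have exp_log : exp ρ * log ρ = 1 := Ring.mul_inverse_cancel _ hunit
  have log_exp : log ρ * exp ρ = 1 := Ring.inverse_mul_cancel _ hunit
  constructor
  · have := congrFun exp_log 0
    rwa [mul_apply_zero, hexp.1, one_mul, one_apply, if_pos rfl] at this
  · intro a
    calc log ρ * ρ a = log ρ * (ρ a * exp ρ) * log ρ := by
          rw [mul_assoc, mul_assoc, exp_log, mul_one]
      _ = const F (ρ a 0) * log ρ := by rw [← hexp.2 a, ← mul_assoc, log_exp, one_mul]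

variable (F) in
/-- The series `A + B τ`. -/
def linear (A B : Matrix ι ι K) : TwistedSeries F K ι := fun n =>
  if n = 0 then A else if n = 1 then B else 0

theorem linear_mul_apply_succ (A B : Matrix ι ι K) (g : TwistedSeries F K ι) (n : ℕ) :
    (linear F A B * g) (n + 1) = A * g (n + 1) + B * twistMat F K ι 1 (g n) := by
  rw [mul_apply_succ, Fin.sum_univ_succ, Finset.sum_eq_zero fun i _ => by simp [linear], add_zero]
  rfl

theorem mul_linear_apply_succ (A B : Matrix ι ι K) (g : TwistedSeries F K ι) (n : ℕ) :
    (g * linear F A B) (n + 1) =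
      g (n + 1) * twistMat F K ι (n + 1) A + g n * twistMat F K ι n B := by
  rw [mul_apply, Finset.Nat.sum_antidiagonal_succ', Finset.sum_eq_single (n, 0)]
  · rfl
  · rintro ⟨i, j⟩ hp hne
    have hj : j ≠ 0 := by
      rintro rfl
      exact hne (by rw [← Finset.HasAntidiagonal.mem_antidiagonal.mp hp, add_zero])
    simp [linear, hj]
  · simp

theorem twistVec_mulVec (n : ℕ) (M : Matrix ι ι K) (x : ι → K) :
    twistVec F n (M.mulVec x) = (twistMat F K ι n M).mulVec (twistVec F n x) := by
  ext b
  simp only [twistVec_apply, Matrix.mulVec, dotProduct, twistMat_apply, Matrix.map_apply,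
    ← frobeniusAlgHom_pow_apply F n, map_sum, map_mul]

theorem linear_mul_apply_eq_zero (A B : Matrix ι ι K) {g : TwistedSeries F K ι} {M : ℕ}
    (hg : ∀ n ≥ M, g n = 0) {n : ℕ} (hn : M + 1 ≤ n) : (linear F A B * g) n = 0 := by
  obtain ⟨n, rfl⟩ : ∃ k, n = k + 1 := ⟨n - 1, by omega⟩
  rw [linear_mul_apply_succ, hg _ (by omega), hg n (by omega), map_zero, mul_zero, mul_zero,
    add_zero]

theorem exists_forall_aeval_linear_apply_eq_zero (A B : Matrix ι ι K) (a : F[X]) :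
    ∃ M, ∀ n ≥ M, (aeval (linear F A B) a : TwistedSeries F K ι) n = 0 := by
  induction a using Polynomial.induction_on with
  | C c =>
    refine ⟨1, fun n hn => ?_⟩
    rw [aeval_C, algebraMap_eq_const, const_apply, if_neg (by omega)]
  | add a b ha hb =>
    obtain ⟨M, hM⟩ := ha
    obtain ⟨M', hM'⟩ := hb
    refine ⟨max M M', fun n hn => ?_⟩
    rw [map_add, add_apply, hM n (le_of_max_le_left hn), hM' n (le_of_max_le_right hn), add_zero]
  | monomial n c h =>
    obtain ⟨M, hM⟩ := h
    refine ⟨M + 1, fun n hn => ?_⟩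
    rw [pow_succ', mul_left_comm, map_mul, aeval_X, linear_mul_apply_eq_zero A B hM hn]

end Algebraic

section Eval

variable {F : Type*} [Field F] [Fintype F] {K : Type*} [Field K] [TopologicalSpace K]
  [Algebra F K] {ι : Type*} [Fintype ι]

theorem eval_eq_sum {g : TwistedSeries F K ι} {M : ℕ} (hg : ∀ n ≥ M, g n = 0) (x : ι → K) :
    g.eval x = ∑ n ∈ Finset.range M, (g n).mulVec (twistVec F n x) := by
  ext b
  rw [eval, tsum_eq_sum (s := Finset.range M), Finset.sum_apply]
  · simp only [← twistVec_apply]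
  · intro n hn
    rw [hg n (by simpa using hn), Matrix.zero_mulVec, Pi.zero_apply]

variable [DecidableEq ι]

theorem eval_linear_mul (A B : Matrix ι ι K) {g : TwistedSeries F K ι} {M : ℕ}
    (hg : ∀ n ≥ M, g n = 0) (x : ι → K) :
    (linear F A B * g).eval x = linearAction F A B (g.eval x) := by
  rw [eval_eq_sum (fun _ => linear_mul_apply_eq_zero A B hg), eval_eq_sum hg, map_sum,
    Finset.sum_range_succ', mul_apply_zero]
  have hA : ∑ n ∈ Finset.range M, A.mulVec ((g (n + 1)).mulVec (twistVec F (n + 1) x)) +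
      A.mulVec ((g 0).mulVec (twistVec F 0 x)) =
      ∑ n ∈ Finset.range M, A.mulVec ((g n).mulVec (twistVec F n x)) := by
    rw [← Finset.sum_range_succ' fun n => A.mulVec ((g n).mulVec (twistVec F n x)),
      Finset.sum_range_succ, hg M le_rfl, Matrix.zero_mulVec, Matrix.mulVec_zero, add_zero]
  simp only [linear_mul_apply_succ, linearAction_apply, Matrix.add_mulVec, ← Matrix.mulVec_mulVec,
    twistVec_mulVec, twistVec_twistVec, Finset.sum_add_distrib, ← hA, add_comm 1]
  exact add_right_comm _ _ _

theorem eval_aeval_linear (A B : Matrix ι ι K) (a : F[X]) (x : ι → K) :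
    (aeval (linear F A B) a : TwistedSeries F K ι).eval x = aeval (linearAction F A B) a x := by
  induction a using Polynomial.induction_on with
  | C c =>
    rw [aeval_C, aeval_C, algebraMap_eq_const, eval_eq_sum (M := 1), Finset.sum_range_one,
      const_apply, if_pos rfl, Algebra.algebraMap_eq_smul_one, Matrix.smul_mulVec,
      Matrix.one_mulVec, Module.algebraMap_end_apply]
    · rfl
    · intro n hn
      rw [const_apply, if_neg (by omega)]
  | add a b ha hb =>
    obtain ⟨M, hM⟩ := exists_forall_aeval_linear_apply_eq_zero A B a
    obtain ⟨M', hM'⟩ := exists_forall_aeval_linear_apply_eq_zero A B b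
    have hM₁ (n) (hn : n ≥ max M M') := hM n (le_of_max_le_left hn)
    have hM₂ (n) (hn : n ≥ max M M') := hM' n (le_of_max_le_right hn)
    rw [map_add, map_add, LinearMap.add_apply, ← ha, ← hb, eval_eq_sum hM₁, eval_eq_sum hM₂,
      eval_eq_sum (M := max M M') fun n hn => by rw [add_apply, hM₁ n hn, hM₂ n hn, add_zero],
      ← Finset.sum_add_distrib]
    simp only [add_apply, Matrix.add_mulVec]
  | monomial n c h =>
    obtain ⟨M, hM⟩ := exists_forall_aeval_linear_apply_eq_zero A B (C c * X ^ n)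
    rw [pow_succ', mul_left_comm, map_mul, map_mul (aeval (linearAction F A B)) X, aeval_X, aeval_X,
      eval_linear_mul A B hM, h, Module.End.mul_apply]

end Eval

end TwistedSeries

theorem norm_algebraMap_le_one {F K : Type*} [Field F] [Finite F] [NormedField K] [Algebra F K]
    (c : F) : ‖algebraMap F K c‖ ≤ 1 := by
  have := Fintype.ofFinite F
  have h : ‖algebraMap F K c‖ ^ Fintype.card F = ‖algebraMap F K c‖ := by
    rw [← norm_pow, ← map_pow, FiniteField.pow_card]
  by_contra! h1
  exact (lt_self_pow₀ h1 (Fintype.one_lt_card (α := F))).ne h.symm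

theorem tendsto_pow_mul_pow_pow_atTop {B x : ℝ} (hB : 0 ≤ B) (hx : 0 ≤ x) (hx1 : x < 1) {q : ℕ}
    (hq : 2 ≤ q) : Tendsto (fun k : ℕ => B ^ k * x ^ q ^ k) atTop (𝓝 0) := by
  obtain ⟨M, hM⟩ := pow_unbounded_of_one_lt B (show (1 : ℝ) < q by exact_mod_cast hq)
  have hlim := (tendsto_pow_const_mul_const_pow_of_abs_lt_one M
    (by rwa [abs_of_nonneg hx])).comp (tendsto_pow_atTop_atTop_of_one_lt (by omega : 1 < q))
  refine squeeze_zero (fun k => by positivity) (fun k => ?_) hlim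
  dsimp only [Function.comp_apply]
  gcongr
  rw [Nat.cast_pow, ← pow_mul, mul_comm k M, pow_mul]
  gcongr

theorem summable_mul_pow_pow {K : Type*} [NormedField K] [IsUltrametricDist K] [CompleteSpace K]
    {B : ℝ} (hB : 0 ≤ B) {a : ℕ → K} (ha : ∀ k, ‖a k‖ ≤ B ^ k) {z : K} (hz : ‖z‖ < 1) {q : ℕ}
    (hq : 2 ≤ q) : Summable fun k => a k * z ^ q ^ k := by
  refine NonarchimedeanAddGroup.summable_of_tendsto_cofinite_zero ?_
  rw [Nat.cofinite_eq_atTop]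
  refine squeeze_zero_norm (fun k => ?_) (tendsto_pow_mul_pow_pow_atTop hB (norm_nonneg z) hz hq)
  rw [norm_mul, norm_pow]
  gcongr
  exact ha k

section UnitBalls

variable (F : Type*) [Field F] [Finite F] (K : Type*) [NormedField K] [IsUltrametricDist K]
  [Algebra F K]

/-- The valuation ring `|x| ≤ 1`, as an algebra over the finite field of constants. -/
def closedUnitBall : Subalgebra F K where
  carrier := {x | ‖x‖ ≤ 1}
  mul_mem' hx hy := (norm_mul_le _ _).trans (mul_le_one₀ hx (norm_nonneg _) hy)
  add_mem' hx hy := (IsUltrametricDist.norm_add_le_max _ _).trans (max_le hx hy)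
  algebraMap_mem' := norm_algebraMap_le_one

/-- The maximal ideal `|x| < 1`, as a vector space over the finite field of constants. -/
def openUnitBall : Submodule F K where
  carrier := {x | ‖x‖ < 1}
  add_mem' hx hy := (IsUltrametricDist.norm_add_le_max _ _).trans_lt (max_lt hx hy)
  zero_mem' := by
    rw [Set.mem_ofPred_eq, norm_zero]
    exact one_pos
  smul_mem' a x hx := by
    rw [Set.mem_ofPred_eq, Algebra.smul_def, norm_mul]
    exact mul_lt_one_of_nonneg_of_lt_one_right (norm_algebraMap_le_one a) (norm_nonneg _) hx

/-- The open unit polydisc, on which the logarithms of `t`-modules converge. -/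
def polydisc (ι : Type*) : Submodule F (ι → K) := Submodule.pi Set.univ fun _ => openUnitBall F K

variable {F K}

theorem mem_openUnitBall {x : K} : x ∈ openUnitBall F K ↔ ‖x‖ < 1 := Iff.rfl

theorem mem_polydisc {ι : Type*} {x : ι → K} : x ∈ polydisc F K ι ↔ ∀ c, ‖x c‖ < 1 := by
  simp only [polydisc, Submodule.mem_pi, Set.mem_univ, forall_const, mem_openUnitBall]

theorem mulVec_mem_polydisc {ι : Type*} [Fintype ι] {M : Matrix ι ι K} (hM : ∀ b c, ‖M b c‖ ≤ 1)
    {x : ι → K} (hx : x ∈ polydisc F K ι) : M.mulVec x ∈ polydisc F K ι := by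
  refine mem_polydisc.mpr fun b => mem_openUnitBall.mp
    (sum_mem fun c _ => (mem_openUnitBall (F := F)).mpr ?_)
  rw [norm_mul]
  exact mul_lt_one_of_nonneg_of_lt_one_right (hM b c) (norm_nonneg _) (mem_polydisc.mp hx c)

end UnitBalls

namespace TwistedSeries

section Row

variable {F : Type*} [Field F] [Fintype F] {K : Type*} [Field K] [Algebra F K] {ι : Type*}
  [Fintype ι] [DecidableEq ι]

variable (F) in
/-- A row `p = ∑ p k τ ^ k` of twisted series with `p (A + B τ) = θ p`. The rows of the logarithm of
a `t`-module that sit at a last index of a block are of this kind. -/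
structure IsEigenrow (A B : Matrix ι ι K) (θ : K) (p : ℕ → ι → K) : Prop where
  zero : Matrix.vecMul (p 0) A = θ • p 0
  succ : ∀ k, Matrix.vecMul (p (k + 1)) (twistMat F K ι (k + 1) A) +
    Matrix.vecMul (p k) (twistMat F K ι k B) = θ • p (k + 1)

theorem isEigenrow_of_mul_linear_eq {A B : Matrix ι ι K} {g : TwistedSeries F K ι}
    (hg : g * linear F A B = const F A * g) {i : ι} {θ : K} (hA : A i = Pi.single i θ) :
    IsEigenrow F A B θ fun k => g k i := by
  have hrow (M : Matrix ι ι K) : (A * M) i = θ • M i := by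
    rw [Matrix.mul_apply_eq_vecMul, hA, Matrix.single_vecMul]
    rfl
  constructor
  · have h := congrFun (congrFun hg 0) i
    rwa [mul_apply_zero, const_mul_apply, hrow, Matrix.mul_apply_eq_vecMul] at h
  · intro k
    have h := congrFun (congrFun hg (k + 1)) i
    rw [mul_linear_apply_succ, const_mul_apply, hrow] at h
    rw [← h]
    rfl

end Row

section Polydisc

variable {F : Type*} [Field F] [Fintype F] {K : Type*} [NormedField K] [IsUltrametricDist K]
  [Algebra F K] {ι : Type*} {x : ι → K}

theorem twistVec_mem_polydisc (n : ℕ) (hx : x ∈ polydisc F K ι) :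
    twistVec F n x ∈ polydisc F K ι := by
  refine mem_polydisc.mpr fun c => ?_
  rw [twistVec_apply, norm_pow]
  exact pow_lt_one₀ (norm_nonneg _) (mem_polydisc.mp hx c) (pow_ne_zero n Fintype.card_ne_zero)

theorem linearAction_mem_polydisc [Fintype ι] {A B : Matrix ι ι K} (hA : ∀ b c, ‖A b c‖ ≤ 1)
    (hB : ∀ b c, ‖B b c‖ ≤ 1) (hx : x ∈ polydisc F K ι) :
    linearAction F A B x ∈ polydisc F K ι :=
  add_mem (mulVec_mem_polydisc hA hx) (mulVec_mem_polydisc hB (twistVec_mem_polydisc 1 hx))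

end Polydisc

section RowEval

variable {F : Type*} [Field F] [Fintype F] {K : Type*} [NormedField K] [Algebra F K] {ι : Type*}
  [Fintype ι]

variable (F) in
/-- The value at `x` of the row `∑ k, p k τ ^ k`. -/
def rowEval (p : ℕ → ι → K) (x : ι → K) : K := ∑' k, p k ⬝ᵥ twistVec F k x

theorem eval_apply (f : TwistedSeries F K ι) (x : ι → K) (i : ι) :
    f.eval x i = rowEval F (fun k => f k i) x := by
  simp only [eval, rowEval, Matrix.mulVec, ← twistVec_apply]

theorem rowEval_smul (p : ℕ → ι → K) (a : F) (x : ι → K) :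
    rowEval F p (a • x) = algebraMap F K a * rowEval F p x := by
  rw [rowEval, rowEval, ← tsum_mul_left]
  refine tsum_congr fun k => ?_
  rw [map_smul, dotProduct_smul, Algebra.smul_def]

variable [IsUltrametricDist K] [CompleteSpace K] {p : ℕ → ι → K} {x y : ι → K}

theorem summable_dotProduct_twistVec (hp : ∃ B : ℝ, 0 ≤ B ∧ ∀ k c, ‖p k c‖ ≤ B ^ k)
    (hx : x ∈ polydisc F K ι) : Summable fun k => p k ⬝ᵥ twistVec F k x := by
  obtain ⟨B, hB, hp⟩ := hp
  refine summable_sum fun c _ => ?_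
  simp only [twistVec_apply]
  exact summable_mul_pow_pow hB (hp · c) (mem_polydisc.mp hx c) Fintype.one_lt_card

theorem rowEval_add (hp : ∃ B : ℝ, 0 ≤ B ∧ ∀ k c, ‖p k c‖ ≤ B ^ k) (hx : x ∈ polydisc F K ι)
    (hy : y ∈ polydisc F K ι) : rowEval F p (x + y) = rowEval F p x + rowEval F p y := by
  simp only [rowEval, map_add, dotProduct_add]
  exact (summable_dotProduct_twistVec hp hx).tsum_add (summable_dotProduct_twistVec hp hy)

variable [DecidableEq ι] {A B : Matrix ι ι K} {θ : K}

theorem rowEval_linearAction (hp : ∃ B : ℝ, 0 ≤ B ∧ ∀ k c, ‖p k c‖ ≤ B ^ k)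
    (heig : IsEigenrow F A B θ p) (hA : ∀ b c, ‖A b c‖ ≤ 1) (hB : ∀ b c, ‖B b c‖ ≤ 1)
    (hx : x ∈ polydisc F K ι) : rowEval F p (linearAction F A B x) = θ * rowEval F p x := by
  let α (k : ℕ) : K := p k ⬝ᵥ twistVec F k (A.mulVec x)
  let β (k : ℕ) : K := p k ⬝ᵥ twistVec F k (B.mulVec (twistVec F 1 x))
  have hAx := mulVec_mem_polydisc hA hx
  have hBx := mulVec_mem_polydisc hB (twistVec_mem_polydisc 1 hx)
  have hα : Summable α := summable_dotProduct_twistVec hp hAx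
  have hβ : Summable β := summable_dotProduct_twistVec hp hBx
  have α_zero : α 0 = θ * (p 0 ⬝ᵥ twistVec F 0 x) := by
    simp only [α, twistVec_mulVec, twistMat_zero, Matrix.dotProduct_mulVec, heig.zero,
      smul_dotProduct, smul_eq_mul]
  have α_succ_add_β (k : ℕ) : α (k + 1) + β k = θ * (p (k + 1) ⬝ᵥ twistVec F (k + 1) x) := by
    simp only [α, β, twistVec_mulVec, twistVec_twistVec, Matrix.dotProduct_mulVec,
      ← add_dotProduct, heig.succ, smul_dotProduct, smul_eq_mul]
  calc rowEval F p (linearAction F A B x) = ∑' k, α k + ∑' k, β k := by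
        rw [linearAction_apply, rowEval_add hp hAx hBx]
        rfl
    _ = α 0 + ∑' k, (α (k + 1) + β k) := by
        rw [hα.tsum_eq_zero_add, add_assoc, ((summable_nat_add_iff 1).mpr hα).tsum_add hβ]
    _ = θ * rowEval F p x := by
        simp only [α_zero, α_succ_add_β, tsum_mul_left]
        rw [← mul_add, rowEval, (summable_dotProduct_twistVec hp hx).tsum_eq_zero_add]

theorem rowEval_aeval_linearAction (hp : ∃ B : ℝ, 0 ≤ B ∧ ∀ k c, ‖p k c‖ ≤ B ^ k)
    (heig : IsEigenrow F A B θ p) (hA : ∀ b c, ‖A b c‖ ≤ 1) (hB : ∀ b c, ‖B b c‖ ≤ 1) (a : F[X])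
    (hx : x ∈ polydisc F K ι) :
    rowEval F p (aeval (linearAction F A B) a x) = aeval θ a * rowEval F p x := by
  have hmem (b : F[X]) : aeval (linearAction F A B) b x ∈ polydisc F K ι :=
    aeval_apply_mem (fun _ => linearAction_mem_polydisc hA hB) b hx
  induction a using Polynomial.induction_on with
  | C c => rw [aeval_C, aeval_C, Module.algebraMap_end_apply, rowEval_smul]
  | add a b ha hb =>
    rw [map_add, map_add, LinearMap.add_apply, rowEval_add hp (hmem a) (hmem b), ha, hb, add_mul]
  | monomial n c h =>
    rw [pow_succ', mul_left_comm, map_mul, map_mul (aeval θ) X, aeval_X, aeval_X,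
      Module.End.mul_apply, rowEval_linearAction hp heig hA hB (hmem _), h, mul_assoc]

end RowEval

end TwistedSeries

namespace CMSPL

section NestedSum

variable {K : Type*} [CommRing K] (g : ℕ → ℕ → K)

/-- The nested sum `∑_{k ≥ j_m ≥ ⋯ ≥ j_1 ≥ 0} g_{m-1}(j_m) ⋯ g_0(j_1)`. -/
def nestedSum (k : ℕ) : ℕ → K
  | 0 => 1
  | m + 1 => ∑ j : Fin (k + 1), g m j * nestedSum j m

/-- The nested sum over `k > j_m ≥ ⋯ ≥ j_1 ≥ 0`. -/
def strictNestedSum : ℕ → ℕ → K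
  | 0, m => if m = 0 then 1 else 0
  | k + 1, m => nestedSum g k m

theorem nestedSum_zero (k : ℕ) : nestedSum g k 0 = 1 := by rw [nestedSum]

theorem nestedSum_succ (k m : ℕ) :
    nestedSum g k (m + 1) = ∑ j ∈ Finset.range (k + 1), g m j * nestedSum g j m := by
  rw [Finset.sum_range, nestedSum]

theorem strictNestedSum_zero (k : ℕ) : strictNestedSum g k 0 = 1 := by
  cases k with
  | zero => rw [strictNestedSum, if_pos rfl]
  | succ k => rw [strictNestedSum, nestedSum_zero]

theorem nestedSum_succ_eq_add (k m : ℕ) :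
    nestedSum g k (m + 1) = strictNestedSum g k (m + 1) + g m k * nestedSum g k m := by
  rw [nestedSum_succ]
  cases k with
  | zero => simp [strictNestedSum]
  | succ k => rw [Finset.sum_range_succ, strictNestedSum, nestedSum_succ]

theorem nestedSum_eq_sum (k m : ℕ) :
    nestedSum g k m =
      ∑ l ∈ Finset.range (m + 1), strictNestedSum g k l * ∏ e ∈ Finset.Ico l m, g e k := by
  induction m with
  | zero => simp [nestedSum_zero, strictNestedSum_zero]
  | succ m ih =>
    rw [nestedSum_succ_eq_add, Finset.sum_range_succ, Finset.Ico_self, Finset.prod_empty, mul_one,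
      add_comm, ih, Finset.mul_sum]
    congr 1
    refine Finset.sum_congr rfl fun l hl => ?_
    rw [Finset.prod_Ico_succ_top (Nat.lt_succ_iff.mp (Finset.mem_range.mp hl))]
    ring

theorem mul_nestedSum_eq_sum (k m : ℕ) :
    g m k * nestedSum g k m =
      ∑ l ∈ Finset.range (m + 1), strictNestedSum g k l * ∏ e ∈ Finset.Ico l (m + 1), g e k := by
  have h := nestedSum_succ_eq_add g k m
  rw [nestedSum_eq_sum, Finset.sum_range_succ, Finset.Ico_self, Finset.prod_empty, mul_one,
    add_comm] at h
  exact (add_left_cancel h).symm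

theorem nestedSum_congr {g g' : ℕ → ℕ → K} {m : ℕ} (h : ∀ e < m, g e = g' e) (k : ℕ) :
    nestedSum g k m = nestedSum g' k m := by
  induction m generalizing k with
  | zero => rw [nestedSum_zero, nestedSum_zero]
  | succ m ih =>
    rw [nestedSum_succ, nestedSum_succ]
    exact Finset.sum_congr rfl fun j _ => by
      rw [h m m.lt_succ_self, ih fun e he => h e (he.trans m.lt_succ_self)]

end NestedSum

section Entry

variable {r : ℕ}

theorem entry_val_add_one {α : Type*} [Zero α] (x : Fin r → α) (e : Fin r) :
    entry x (e + 1) = x e := by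
  rw [entry, dif_pos (by omega)]
  rfl

theorem entry_comp_rev {α : Type*} [Zero α] (x : Fin r → α) {e : ℕ} (he : e < r) :
    entry (x ∘ Fin.rev) (e + 1) = entry x (r - e) := by
  rw [entry, entry, dif_pos (by omega), dif_pos (by omega), Function.comp_apply]
  congr 1

theorem prod_Ico_eq_prod_entry {M : Type*} [CommMonoidWithZero M] (u : Fin r → M) (l m : Fin r) :
    ∏ e ∈ Finset.Ico l m, u e = ∏ e ∈ Finset.Ico (l : ℕ) m, entry u (e + 1) := by
  rw [← Fin.map_valEmbedding_Ico, Finset.prod_map]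
  exact Finset.prod_congr rfl fun e _ => (entry_val_add_one u e).symm

theorem prod_Ici_eq_prod_entry {M : Type*} [CommMonoidWithZero M] (u : Fin r → M) (l : Fin r) :
    ∏ e ∈ Finset.Ici l, u e = ∏ e ∈ Finset.Ico (l : ℕ) r, entry u (e + 1) := by
  rw [← Fin.map_valEmbedding_Ici, Finset.prod_map]
  exact Finset.prod_congr rfl fun e _ => (entry_val_add_one u e).symm

theorem blockDim_eq_sum_entry (s : Fin r → ℕ) (l : Fin r) :
    blockDim s l = ∑ e ∈ Finset.Ico (l : ℕ) r, entry s (e + 1) := by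
  rw [blockDim, ← Fin.map_valEmbedding_Ici, Finset.sum_map]
  exact Finset.sum_congr rfl fun e _ => (entry_val_add_one s e).symm

theorem blockDim_eq_add (s : Fin r → ℕ) {l m : Fin r} (h : l ≤ m) :
    blockDim s l = ∑ e ∈ Finset.Ico (l : ℕ) m, entry s (e + 1) + blockDim s m := by
  rw [blockDim_eq_sum_entry, blockDim_eq_sum_entry,
    Finset.sum_Ico_consecutive _ (by exact h) m.2.le]

theorem blockDim_comp_rev_pos {s : Fin r → ℕ} (hr : 0 < r) (hs : 0 < s ⟨0, hr⟩) (l : Fin r) :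
    0 < blockDim (s ∘ Fin.rev) l := by
  have hmem : Fin.rev ⟨0, hr⟩ ∈ Finset.Ici l :=
    Finset.mem_Ici.mpr (Fin.le_rev_iff.mpr (Fin.mk_le_of_le_val (Nat.zero_le _)))
  refine Finset.sum_pos' (fun _ _ => Nat.zero_le _) ⟨_, hmem, ?_⟩
  rwa [Function.comp_apply, Fin.rev_rev]

end Entry

section LastIdx

variable {r : ℕ} {s : Fin r → ℕ} (hd : ∀ l, 0 < blockDim s l)

/-- The last index of the block `m`, that is the row of `ρ_t` in which `N` vanishes. -/
def lastIdx (m : Fin r) : Idx s :=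
  ⟨m, ⟨blockDim s m - 1, Nat.sub_lt (hd m) Nat.one_pos⟩⟩

theorem lastIdx_snd_add_one (m : Fin r) : ((lastIdx hd m).2 : ℕ) + 1 = blockDim s m :=
  Nat.sub_add_cancel (hd m)

theorem val_rev_lastIdx_snd (m : Fin r) :
    (Fin.rev (n := blockDim s m) (lastIdx hd m).2 : ℕ) = 0 :=
  Nat.sub_eq_zero_of_le (lastIdx_snd_add_one hd m).ge

theorem eq_lastIdx {x : Idx s} (hx : (x.2 : ℕ) + 1 = blockDim s x.1) : x = lastIdx hd x.1 := by
  obtain ⟨m, j⟩ := x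
  exact congrArg (Sigma.mk m) (Fin.ext (Nat.eq_sub_of_add_eq hx))

theorem sum_eq_sum_lastIdx {M : Type*} [AddCommMonoid M] {f : Idx s → M}
    (hf : ∀ x, (x.2 : ℕ) + 1 ≠ blockDim s x.1 → f x = 0) :
    ∑ x, f x = ∑ m, f (lastIdx hd m) := by
  rw [Fintype.sum_sigma]
  refine Finset.sum_congr rfl fun m _ => Finset.sum_eq_single _ (fun j _ hj => hf _ fun h => hj ?_)
    fun h => (h (Finset.mem_univ _)).elim
  exact Fin.ext (Nat.eq_sub_of_add_eq h)

end LastIdx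

section Matrices

variable {F : Type*} [Field F] {K : Type*} [Field K] [Algebra F K] {r : ℕ} {s : Fin r → ℕ}

theorem matN_pow_apply_eq_zero (n : ℕ) (x y : Idx s) (h : (y.2 : ℕ) < x.2 + n) :
    (matN s ^ n : Matrix (Idx s) (Idx s) K) x y = 0 := by
  induction n generalizing y with
  | zero =>
    rw [pow_zero, Matrix.one_apply_ne]
    rintro rfl
    exact h.false
  | succ n ih =>
    rw [pow_succ, Matrix.mul_apply]
    refine Finset.sum_eq_zero fun z _ => ?_
    by_cases hz : z.1 = y.1 ∧ (y.2 : ℕ) = z.2 + 1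
    · rw [ih z (by omega), zero_mul]
    · rw [matN, if_neg hz, mul_zero]

theorem isNilpotent_matN : IsNilpotent (matN s : Matrix (Idx s) (Idx s) K) := by
  refine ⟨∑ e, s e, Matrix.ext fun x y => matN_pow_apply_eq_zero _ x y ?_⟩
  have hle : blockDim s y.1 ≤ ∑ e, s e := Finset.sum_le_sum_of_subset (Finset.subset_univ _)
  have := y.2.2
  omega

theorem matN_lastIdx (hd : ∀ l, 0 < blockDim s l) (m : Fin r) :
    (matN s : Matrix (Idx s) (Idx s) K) (lastIdx hd m) = 0 := by
  ext x
  refine if_neg fun ⟨h₁, h₂⟩ => x.2.2.ne ?_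
  rw [h₂, lastIdx_snd_add_one, ← h₁]
  rfl

theorem scalar_add_matN_lastIdx (hd : ∀ l, 0 < blockDim s l) (m : Fin r) (θ : K) :
    (Matrix.scalar (Idx s) θ + matN s : Matrix (Idx s) (Idx s) K) (lastIdx hd m) =
      Pi.single (lastIdx hd m) θ := by
  ext y
  rw [Matrix.add_apply, congrFun (matN_lastIdx hd m) y, Pi.zero_apply, add_zero,
    Matrix.scalar_apply, Matrix.diagonal_apply, Pi.single_apply]
  exact if_congr eq_comm rfl rfl

theorem scalar_add_matN_apply_mem (S : Subalgebra F K) {θ : K} (hθ : θ ∈ S) (x y : Idx s) :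
    (Matrix.scalar (Idx s) θ + matN s : Matrix (Idx s) (Idx s) K) x y ∈ S := by
  rw [Matrix.add_apply, Matrix.scalar_apply, Matrix.diagonal_apply, matN]
  refine add_mem ?_ ?_ <;> split_ifs
  exacts [hθ, zero_mem S, one_mem S, zero_mem S]

theorem matE_apply_mem (S : Subalgebra F K) {u : Fin r → K} (hu : ∀ i, u i ∈ S) (x y : Idx s) :
    matE s u x y ∈ S := by
  rw [matE]
  split_ifs
  exacts [mul_mem (pow_mem (neg_mem (one_mem S)) _) (prod_mem fun i _ => hu i), zero_mem S]

theorem specialPoint_apply_mem (S : Subalgebra F K) {u : Fin r → K} (hu : ∀ i, u i ∈ S)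
    (x : Idx s) : specialPoint s u x ∈ S := by
  rw [specialPoint]
  split_ifs
  exacts [mul_mem (pow_mem (neg_mem (one_mem S)) _) (prod_mem fun i _ => hu i), zero_mem S]

theorem vecMul_matN_zero (p : Idx s → K) (m : Fin r) (h : 0 < blockDim s m) :
    Matrix.vecMul p (matN s) ⟨m, ⟨0, h⟩⟩ = 0 := by
  simp only [Matrix.vecMul, dotProduct]
  exact Finset.sum_eq_zero fun z _ => by rw [matN, if_neg (by simp), mul_zero]

theorem vecMul_matN_succ (p : Idx s → K) (m : Fin r) (j : ℕ) (h : j + 1 < blockDim s m) :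
    Matrix.vecMul p (matN s) ⟨m, ⟨j + 1, h⟩⟩ = p ⟨m, ⟨j, by omega⟩⟩ := by
  simp only [Matrix.vecMul, dotProduct]
  rw [Finset.sum_eq_single ⟨m, ⟨j, by omega⟩⟩]
  · rw [matN, if_pos ⟨rfl, rfl⟩, mul_one]
  · rintro ⟨l, i⟩ - hne
    rw [matN, if_neg, mul_zero]
    rintro ⟨rfl, hi⟩
    exact hne (congrArg (Sigma.mk l) (Fin.ext (Nat.succ.inj hi).symm))
  · exact fun h => (h (Finset.mem_univ _)).elim

variable [Fintype F]

theorem twistMat_matN (n : ℕ) :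
    twistMat F K (Idx s) n (matN s) = matN s := by
  ext x y
  rw [twistMat_apply, Matrix.map_apply, matN]
  split_ifs
  · exact one_pow _
  · exact zero_pow (pow_ne_zero n Fintype.card_ne_zero)

theorem vecMul_twistMat_scalar_add_matN (n : ℕ) (θ : K) (p : Idx s → K) :
    Matrix.vecMul p (twistMat F K (Idx s) n (Matrix.scalar (Idx s) θ + matN s)) =
      θ ^ Fintype.card F ^ n • p + Matrix.vecMul p (matN s) := by
  rw [map_add, TwistedSeries.twistMat_scalar, twistMat_matN, Matrix.vecMul_add]
  congr 1
  ext x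
  rw [Matrix.scalar_apply, Matrix.vecMul_diagonal, mul_comm, Pi.smul_apply, smul_eq_mul]

theorem vecMul_twistMat_matE_of_ne_zero (n : ℕ) (u : Fin r → K) (p : Idx s → K) {x : Idx s}
    (hx : (x.2 : ℕ) ≠ 0) :
    Matrix.vecMul p (twistMat F K (Idx s) n (matE s u)) x = 0 := by
  simp only [Matrix.vecMul, dotProduct, twistMat_apply, Matrix.map_apply]
  refine Finset.sum_eq_zero fun z _ => ?_
  rw [matE, if_neg (fun h => hx h.2.2),
    zero_pow (pow_ne_zero n Fintype.card_ne_zero), mul_zero]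

theorem vecMul_twistMat_matE_zero (hd : ∀ l, 0 < blockDim s l) (n : ℕ) (u : Fin r → K)
    (p : Idx s → K) (m : Fin r) :
    Matrix.vecMul p (twistMat F K (Idx s) n (matE s u)) ⟨m, ⟨0, hd m⟩⟩ =
      ∑ l ∈ Finset.Iic m, p (lastIdx hd l) * ((-1) ^ ((m : ℕ) - l) *
        ∏ e ∈ Finset.Ico (l : ℕ) m, entry u (e + 1) ^ Fintype.card F ^ n) := by
  have hzero : (0 : K) ^ Fintype.card F ^ n = 0 := zero_pow (pow_ne_zero n Fintype.card_ne_zero)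
  simp only [Matrix.vecMul, dotProduct, twistMat_apply, Matrix.map_apply]
  rw [sum_eq_sum_lastIdx hd]
  · rw [← Finset.sum_subset (Finset.subset_univ (Finset.Iic m))]
    · refine Finset.sum_congr rfl fun l hl => ?_
      rw [matE, if_pos ⟨Finset.mem_Iic.mp hl, lastIdx_snd_add_one hd l, rfl⟩, mul_pow,
        neg_one_pow_pow_card_pow, prod_Ico_eq_prod_entry, Finset.prod_pow]
      rfl
    · intro l _ hl
      rw [matE, if_neg (fun h => hl (Finset.mem_Iic.mpr h.1)), hzero, mul_zero]
  · intro z hz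
    rw [matE, if_neg (fun h => hz h.2.1), hzero, mul_zero]

theorem dotProduct_twistVec_specialPoint (hd : ∀ l, 0 < blockDim s l) (n : ℕ) (u : Fin r → K)
    (p : Idx s → K) :
    p ⬝ᵥ TwistedSeries.twistVec F n (specialPoint s u) =
      ∑ m, p (lastIdx hd m) * ((-1) ^ (r - 1 - (m : ℕ)) *
        ∏ e ∈ Finset.Ico (m : ℕ) r, entry u (e + 1) ^ Fintype.card F ^ n) := by
  rw [dotProduct, sum_eq_sum_lastIdx hd]
  · refine Finset.sum_congr rfl fun m _ => ?_
    rw [TwistedSeries.twistVec_apply, specialPoint, if_pos (by exact lastIdx_snd_add_one hd m),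
      mul_pow, neg_one_pow_pow_card_pow, prod_Ici_eq_prod_entry, Finset.prod_pow]
    rfl
  · intro x hx
    rw [TwistedSeries.twistVec_apply, specialPoint, if_neg hx,
      zero_pow (pow_ne_zero n Fintype.card_ne_zero), mul_zero]

end Matrices

section LiFactor

variable (F : Type*) [Fintype F] {K : Type*} [NormedField K] (θ : K) {r : ℕ} (s : Fin r → ℕ)
  (u : Fin r → K)

/-- The factor `u_{e+1}^{q^k} / L_k^{s_{e+1}}` of a term of a CMSPL series. -/
def liFactor (e k : ℕ) : K :=
  entry u (e + 1) ^ Fintype.card F ^ k / bigL F θ k ^ entry s (e + 1)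

theorem prod_Ico_liFactor (l m k : ℕ) :
    ∏ e ∈ Finset.Ico l m, liFactor F θ s u e k =
      (∏ e ∈ Finset.Ico l m, entry u (e + 1) ^ Fintype.card F ^ k) /
        bigL F θ k ^ ∑ e ∈ Finset.Ico l m, entry s (e + 1) := by
  simp only [liFactor, Finset.prod_div_distrib, Finset.prod_pow_eq_pow_sum]

theorem bigL_zero : bigL F θ 0 = 1 := by simp [bigL]

theorem bigL_succ (k : ℕ) :
    bigL F θ (k + 1) = bigL F θ k * (θ - θ ^ Fintype.card F ^ (k + 1)) :=
  Finset.prod_Icc_succ_top (Nat.le_add_left 1 k) _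

variable {F θ} in
theorem bigL_ne_zero (hθ : ∀ n ≠ 0, θ ^ Fintype.card F ^ n ≠ θ) (k : ℕ) : bigL F θ k ≠ 0 :=
  Finset.prod_ne_zero_iff.mpr fun n hn =>
    sub_ne_zero.mpr (hθ n (Nat.one_le_iff_ne_zero.mp (Finset.mem_Icc.mp hn).1)).symm

end LiFactor

section Eigenrow

variable {F : Type*} [Field F] [Fintype F] {K : Type*} [NormedField K] [Algebra F K] {r : ℕ}
  {s : Fin r → ℕ} {θ : K} {u : Fin r → K} {p : ℕ → Idx s → K}

theorem sub_pow_mul_eigenrow_succ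
    (hp : TwistedSeries.IsEigenrow F (Matrix.scalar (Idx s) θ + matN s) (matE s u) θ p) (k : ℕ)
    (x : Idx s) :
    (θ - θ ^ Fintype.card F ^ (k + 1)) * p (k + 1) x =
      Matrix.vecMul (p (k + 1)) (matN s) x +
        Matrix.vecMul (p k) (twistMat F K (Idx s) k (matE s u)) x := by
  have h := congrFun (hp.succ k) x
  rw [vecMul_twistMat_scalar_add_matN, Pi.add_apply, Pi.add_apply, Pi.smul_apply, Pi.smul_apply,
    smul_eq_mul, smul_eq_mul] at h
  rw [sub_mul, ← h]
  ring

theorem eigenrow_succ_apply (hθ : ∀ n ≠ 0, θ ^ Fintype.card F ^ n ≠ θ)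
    (hp : TwistedSeries.IsEigenrow F (Matrix.scalar (Idx s) θ + matN s) (matE s u) θ p)
    (hd : ∀ l, 0 < blockDim s l) (k : ℕ) (m : Fin r) (j : ℕ) (hj : j < blockDim s m) :
    p (k + 1) ⟨m, ⟨j, hj⟩⟩ =
      Matrix.vecMul (p k) (twistMat F K (Idx s) k (matE s u)) ⟨m, ⟨0, hd m⟩⟩ /
        (θ - θ ^ Fintype.card F ^ (k + 1)) ^ (j + 1) := by
  have hδ : θ - θ ^ Fintype.card F ^ (k + 1) ≠ 0 := sub_ne_zero.mpr (hθ _ k.succ_ne_zero).symm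
  induction j with
  | zero =>
    rw [pow_one, eq_div_iff hδ, mul_comm, sub_pow_mul_eigenrow_succ hp, vecMul_matN_zero, zero_add]
  | succ j ih =>
    rw [pow_succ, ← div_div, eq_div_iff hδ, mul_comm, sub_pow_mul_eigenrow_succ hp,
      vecMul_matN_succ, vecMul_twistMat_matE_of_ne_zero _ _ _ (by exact j.succ_ne_zero), add_zero,
      ih]

theorem vecMul_twistMat_matE_zero_eq_nestedSum (hθ : ∀ n ≠ 0, θ ^ Fintype.card F ^ n ≠ θ)
    (hd : ∀ l, 0 < blockDim s l) {k : ℕ} {x : Idx s → K}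
    (hx : ∀ l, x (lastIdx hd l) = (-1) ^ (l : ℕ) / bigL F θ k ^ blockDim s l *
      strictNestedSum (liFactor F θ s u) k l) (m : Fin r) :
    Matrix.vecMul x (twistMat F K (Idx s) k (matE s u)) ⟨m, ⟨0, hd m⟩⟩ =
      (-1) ^ (m : ℕ) / bigL F θ k ^ blockDim s m * nestedSum (liFactor F θ s u) k m := by
  have hL := bigL_ne_zero hθ k
  rw [vecMul_twistMat_matE_zero hd, nestedSum_eq_sum, Finset.mul_sum, Nat.range_succ_eq_Iic,
    ← Fin.map_valEmbedding_Iic, Finset.sum_map]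
  refine Finset.sum_congr rfl fun l hl => ?_
  have hlm := Finset.mem_Iic.mp hl
  have hsign : (-1 : K) ^ (m : ℕ) = (-1) ^ (l : ℕ) * (-1) ^ ((m : ℕ) - l) := by
    rw [← pow_add, Nat.add_sub_cancel' (by exact hlm)]
  rw [hx, Fin.valEmbedding_apply, prod_Ico_liFactor, blockDim_eq_add s hlm, pow_add, hsign]
  field_simp

theorem single_lastIdx_eq (hd : ∀ l, 0 < blockDim s l) (hr : 0 < r) (g : ℕ → ℕ → K) (m : Fin r)
    (j : Fin (blockDim s m)) :
    (Pi.single (lastIdx hd ⟨0, hr⟩) 1 : Idx s → K) ⟨m, j⟩ =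
      (-1) ^ (m : ℕ) * 0 ^ (j.rev : ℕ) * strictNestedSum g 0 m := by
  rw [strictNestedSum, Pi.single_apply]
  by_cases hm : (m : ℕ) = 0
  · obtain rfl : m = ⟨0, hr⟩ := Fin.ext hm
    by_cases hj : (j : ℕ) + 1 = blockDim s ⟨0, hr⟩
    · rw [if_pos (eq_lastIdx hd hj), Fin.val_rev, hj, Nat.sub_self]
      simp
    · have hj' : (j.rev : ℕ) ≠ 0 := by rw [Fin.val_rev]; omega
      rw [if_neg, zero_pow hj', mul_zero, zero_mul]
      exact fun h => hj ((congrArg (fun x : Idx s => (x.2 : ℕ) + 1) h).trans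
        (lastIdx_snd_add_one hd _))
  · rw [if_neg hm, mul_zero, if_neg fun h => hm (congrArg (fun x : Idx s => (x.1 : ℕ)) h)]

theorem eigenrow_apply (hθ : ∀ n ≠ 0, θ ^ Fintype.card F ^ n ≠ θ)
    (hp : TwistedSeries.IsEigenrow F (Matrix.scalar (Idx s) θ + matN s) (matE s u) θ p)
    (hd : ∀ l, 0 < blockDim s l) (hr : 0 < r) (hp₀ : p 0 = Pi.single (lastIdx hd ⟨0, hr⟩) 1)
    (k : ℕ) (m : Fin r) (j : Fin (blockDim s m)) :
    p k ⟨m, j⟩ = (-1) ^ (m : ℕ) * (θ - θ ^ Fintype.card F ^ k) ^ (j.rev : ℕ) /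
      bigL F θ k ^ blockDim s m * strictNestedSum (liFactor F θ s u) k m := by
  induction k generalizing m j with
  | zero =>
    rw [hp₀, single_lastIdx_eq hd hr (liFactor F θ s u), pow_zero, pow_one, sub_self, bigL_zero,
      one_pow, div_one]
  | succ k ih =>
    have hlast (l : Fin r) : p k (lastIdx hd l) = (-1) ^ (l : ℕ) / bigL F θ k ^ blockDim s l *
        strictNestedSum (liFactor F θ s u) k l := by
      have h := ih l (lastIdx hd l).2
      rwa [val_rev_lastIdx_snd, pow_zero, mul_one] at h
    have hδ : θ - θ ^ Fintype.card F ^ (k + 1) ≠ 0 := sub_ne_zero.mpr (hθ _ k.succ_ne_zero).symm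
    have hL := bigL_ne_zero hθ k
    have hj : (θ - θ ^ Fintype.card F ^ (k + 1)) ^ blockDim s m =
        (θ - θ ^ Fintype.card F ^ (k + 1)) ^ (j.rev : ℕ) *
          (θ - θ ^ Fintype.card F ^ (k + 1)) ^ ((j : ℕ) + 1) := by
      rw [← pow_add, Fin.val_rev, Nat.sub_add_cancel j.2]
    rw [eigenrow_succ_apply hθ hp hd, vecMul_twistMat_matE_zero_eq_nestedSum hθ hd hlast,
      strictNestedSum, bigL_succ, mul_pow, hj]
    field_simp

end Eigenrow

section LogRow

variable {F : Type*} [Field F] [Fintype F] {K : Type*} [NormedField K] [Algebra F K] {θ : K} {r : ℕ}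
  {s : Fin r → ℕ} {u : Fin r → K}

theorem exists_isExp_rho (hθ : ∀ n ≠ 0, θ ^ Fintype.card F ^ n ≠ θ) :
    ∃ f, TwistedSeries.IsExp (rho s F θ u) f :=
  TwistedSeries.exists_isExp (by rw [rho, aeval_X]; rfl) isNilpotent_matN hθ

variable (F θ u) in
/-- The row of `log_G` giving the last coordinate of the first block, as a sequence of rows of
coefficients. -/
def logRow (hr : 0 < r) (hd : ∀ l, 0 < blockDim s l) (k : ℕ) : Idx s → K :=
  TwistedSeries.log (rho s F θ u) k (lastIdx hd ⟨0, hr⟩)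

theorem lastOfFirstBlock_eval_log (hr : 0 < r) (hd : ∀ l, 0 < blockDim s l) (x : Idx s → K) :
    lastOfFirstBlock s ((TwistedSeries.log (rho s F θ u)).eval x) =
      TwistedSeries.rowEval F (logRow F θ u hr hd) x :=
  (dif_pos ⟨hr, hd ⟨0, hr⟩⟩).trans (TwistedSeries.eval_apply _ _ _)

theorem logRow_zero (hθ : ∀ n ≠ 0, θ ^ Fintype.card F ^ n ≠ θ) (hr : 0 < r)
    (hd : ∀ l, 0 < blockDim s l) :
    logRow F θ u hr hd 0 = Pi.single (lastIdx hd ⟨0, hr⟩) 1 := by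
  rw [logRow, (TwistedSeries.log_spec (exists_isExp_rho hθ)).1]
  exact funext fun _ => Matrix.one_eq_pi_single

theorem isEigenrow_logRow (hθ : ∀ n ≠ 0, θ ^ Fintype.card F ^ n ≠ θ) (hr : 0 < r)
    (hd : ∀ l, 0 < blockDim s l) :
    TwistedSeries.IsEigenrow F (Matrix.scalar (Idx s) θ + matN s) (matE s u) θ
      (logRow F θ u hr hd) := by
  have h := (TwistedSeries.log_spec (exists_isExp_rho (s := s) (u := u) hθ)).2 X
  rw [rho, aeval_X] at h
  exact TwistedSeries.isEigenrow_of_mul_linear_eq h (scalar_add_matN_lastIdx hd _ θ)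

theorem logRow_apply (hθ : ∀ n ≠ 0, θ ^ Fintype.card F ^ n ≠ θ) (hr : 0 < r)
    (hd : ∀ l, 0 < blockDim s l) (k : ℕ) (m : Fin r) (j : Fin (blockDim s m)) :
    logRow F θ u hr hd k ⟨m, j⟩ = (-1) ^ (m : ℕ) * (θ - θ ^ Fintype.card F ^ k) ^ (j.rev : ℕ) /
      bigL F θ k ^ blockDim s m * strictNestedSum (liFactor F θ s u) k m :=
  eigenrow_apply hθ (isEigenrow_logRow hθ hr hd) hd hr (logRow_zero hθ hr hd) k m j

end LogRow

section Convergence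

/-- The properties of the image of `θ` in `ℂ_v` on which convergence depends: `θ` is integral, and
the differences `θ - θ ^ q ^ n` are bounded away from `0`. -/
structure IsIntegralTheta (F : Type*) [Fintype F] {K : Type*} [NormedField K] (θ : K) : Prop where
  norm_le_one : ‖θ‖ ≤ 1
  exists_le : ∃ c : ℝ, 0 < c ∧ ∀ n ≠ 0, c ≤ ‖θ - θ ^ Fintype.card F ^ n‖

namespace IsIntegralTheta

theorem pow_ne {F K : Type*} [Fintype F] [NormedField K] {θ : K} (hθ : IsIntegralTheta F θ) :
    ∀ n ≠ 0, θ ^ Fintype.card F ^ n ≠ θ := by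
  obtain ⟨c, hc, h⟩ := hθ.exists_le
  intro n hn heq
  have := h n hn
  rw [heq, sub_self, norm_zero] at this
  exact hc.not_ge this

theorem aeval_ne_zero {F K : Type*} [Field F] [Fintype F] [NormedField K] [Algebra F K] {θ : K}
    (hθ : IsIntegralTheta F θ) {a : F[X]} (ha : a ≠ 0) : aeval θ a ≠ 0 := fun h =>
  ha (transcendental_iff.mp (transcendental_of_pow_card_pow_ne hθ.pow_ne) a h)

variable {F K : Type*} [Fintype F] [NormedField K] [IsUltrametricDist K] {θ : K}

theorem norm_sub_pow_le (hθ : IsIntegralTheta F θ) (k : ℕ) :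
    ‖θ - θ ^ Fintype.card F ^ k‖ ≤ 1 := by
  rw [sub_eq_add_neg]
  refine (IsUltrametricDist.norm_add_le_max _ _).trans (max_le hθ.norm_le_one ?_)
  rw [norm_neg, norm_pow]
  exact pow_le_one₀ (norm_nonneg _) hθ.norm_le_one

theorem exists_norm_inv_bigL_le (hθ : IsIntegralTheta F θ) :
    ∃ b : ℝ, 1 ≤ b ∧ ∀ k, ‖(bigL F θ k)⁻¹‖ ≤ b ^ k := by
  obtain ⟨c, hc, h⟩ := hθ.exists_le
  refine ⟨c⁻¹, (one_le_inv₀ hc).mpr ((h 1 one_ne_zero).trans (hθ.norm_sub_pow_le 1)), fun k => ?_⟩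
  induction k with
  | zero => rw [bigL_zero, inv_one, norm_one, pow_zero]
  | succ k ih =>
    rw [bigL_succ, mul_inv, norm_mul, pow_succ, norm_inv (θ - _)]
    exact mul_le_mul ih (inv_anti₀ hc (h _ k.succ_ne_zero)) (by positivity)
      ((norm_nonneg _).trans ih)

end IsIntegralTheta

theorem norm_entry_le_one {K : Type*} [NormedField K] {r : ℕ} {u : Fin r → K}
    (hu : ∀ i, ‖u i‖ ≤ 1) (e : ℕ) : ‖entry u e‖ ≤ 1 := by
  rw [entry]
  split_ifs
  · exact hu _
  · exact norm_zero.trans_le zero_le_one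

section NestedSumBound

variable {F K : Type*} [Fintype F] [NormedField K] {θ : K} {b : ℝ}

theorem norm_pow_div_bigL_pow_le (hL : ∀ k, ‖(bigL F θ k)⁻¹‖ ≤ b ^ k) {w : K} (hw : ‖w‖ ≤ 1)
    (k σ : ℕ) : ‖w ^ Fintype.card F ^ k / bigL F θ k ^ σ‖ ≤ (b ^ k) ^ σ := by
  rw [div_eq_mul_inv, ← inv_pow, norm_mul, norm_pow, norm_pow]
  exact (mul_le_of_le_one_left (by positivity) (pow_le_one₀ (norm_nonneg _) hw)).trans
    (pow_le_pow_left₀ (norm_nonneg _) (hL k) σ)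

variable [IsUltrametricDist K] {r : ℕ} {u : Fin r → K}

theorem norm_nestedSum_le (hb : 1 ≤ b) (hL : ∀ k, ‖(bigL F θ k)⁻¹‖ ≤ b ^ k) (s : Fin r → ℕ)
    (hu : ∀ i, ‖u i‖ ≤ 1) (k m : ℕ) :
    ‖nestedSum (liFactor F θ s u) k m‖ ≤ (b ^ k) ^ ∑ e ∈ Finset.range m, entry s (e + 1) := by
  have : 0 ≤ b := zero_le_one.trans hb
  induction m generalizing k with
  | zero => rw [nestedSum_zero, norm_one, Finset.sum_range_zero, pow_zero]
  | succ m ih =>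
    rw [nestedSum_succ]
    refine IsUltrametricDist.norm_sum_le_of_forall_le_of_nonneg (by positivity) fun j hj => ?_
    have hjk : j ≤ k := Nat.lt_succ_iff.mp (Finset.mem_range.mp hj)
    calc ‖liFactor F θ s u m j * nestedSum (liFactor F θ s u) j m‖
        ≤ (b ^ j) ^ entry s (m + 1) * (b ^ j) ^ ∑ e ∈ Finset.range m, entry s (e + 1) := by
          rw [norm_mul]
          gcongr
          · exact norm_pow_div_bigL_pow_le hL (norm_entry_le_one hu _) j _
          · exact ih j
      _ = (b ^ j) ^ ∑ e ∈ Finset.range (m + 1), entry s (e + 1) := by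
          rw [← pow_add, Finset.sum_range_succ, add_comm]
      _ ≤ (b ^ k) ^ ∑ e ∈ Finset.range (m + 1), entry s (e + 1) := by gcongr

theorem norm_strictNestedSum_le (hb : 1 ≤ b) (hL : ∀ k, ‖(bigL F θ k)⁻¹‖ ≤ b ^ k) (s : Fin r → ℕ)
    (hu : ∀ i, ‖u i‖ ≤ 1) (k m : ℕ) :
    ‖strictNestedSum (liFactor F θ s u) k m‖ ≤
      (b ^ k) ^ ∑ e ∈ Finset.range m, entry s (e + 1) := by
  cases k with
  | zero =>
    rw [strictNestedSum, pow_zero, one_pow]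
    split_ifs
    · exact norm_one.le
    · exact norm_zero.trans_le zero_le_one
  | succ k =>
    refine (norm_nestedSum_le hb hL s hu k m).trans ?_
    gcongr
    exact k.le_succ

end NestedSumBound

theorem exists_norm_logRow_le {F K : Type*} [Field F] [Fintype F] [NormedField K]
    [IsUltrametricDist K] [Algebra F K] {θ : K} (hθ : IsIntegralTheta F θ) {r : ℕ} (hr : 0 < r)
    {s : Fin r → ℕ} (hd : ∀ l, 0 < blockDim s l) {u : Fin r → K} (hu : ∀ i, ‖u i‖ ≤ 1) :
    ∃ B : ℝ, 0 ≤ B ∧ ∀ k x, ‖logRow F θ u hr hd k x‖ ≤ B ^ k := by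
  obtain ⟨b, hb, hL⟩ := hθ.exists_norm_inv_bigL_le
  refine ⟨b ^ ∑ e ∈ Finset.range r, entry s (e + 1), pow_nonneg (zero_le_one.trans hb) _,
    fun k ⟨m, j⟩ => ?_⟩
  rw [logRow_apply hθ.pow_ne, div_eq_mul_inv, ← inv_pow, norm_mul, norm_mul, norm_mul,
    norm_pow, norm_neg, norm_one, one_pow, one_mul, norm_pow, norm_pow]
  calc ‖θ - θ ^ Fintype.card F ^ k‖ ^ (j.rev : ℕ) * ‖(bigL F θ k)⁻¹‖ ^ blockDim s m *
          ‖strictNestedSum (liFactor F θ s u) k m‖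
      ≤ 1 * (b ^ k) ^ blockDim s m * (b ^ k) ^ ∑ e ∈ Finset.range m, entry s (e + 1) := by
        gcongr
        · exact pow_le_one₀ (norm_nonneg _) (hθ.norm_sub_pow_le k)
        · exact hL k
        · exact norm_strictNestedSum_le hb hL s hu k m
    _ = (b ^ ∑ e ∈ Finset.range r, entry s (e + 1)) ^ k := by
        rw [one_mul, ← pow_add, ← pow_mul, ← pow_mul, blockDim_eq_sum_entry, add_comm,
          Finset.sum_range_add_sum_Ico _ m.2.le, mul_comm]

end Convergence

section AntitoneTuples

/-- The weakly decreasing tuples with entries at most `k`. -/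
def antitoneTuples (m k : ℕ) : Finset (Fin m → ℕ) :=
  open Classical in {i ∈ Fintype.piFinset fun _ => Finset.range (k + 1) | Antitone i}

theorem mem_antitoneTuples {m k : ℕ} {i : Fin m → ℕ} :
    i ∈ antitoneTuples m k ↔ (∀ n, i n ≤ k) ∧ Antitone i := by
  simp [antitoneTuples]

theorem antitone_cons_iff {m k : ℕ} {i : Fin m → ℕ} :
    Antitone (Fin.cons k i : Fin (m + 1) → ℕ) ↔ i ∈ antitoneTuples m k := by
  rw [mem_antitoneTuples]
  constructor
  · exact fun h => ⟨fun n => h (Fin.zero_le n.succ),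
      fun _ _ hab => h (Fin.succ_le_succ_iff.mpr hab)⟩
  · rintro ⟨hle, hanti⟩ a b hab
    cases b using Fin.cases with
    | zero => rw [Fin.le_zero_iff.mp hab]
    | succ b =>
      cases a using Fin.cases with
      | zero => exact hle b
      | succ a => exact hanti (Fin.succ_le_succ_iff.mp hab)

/-- Splitting off the first entry of a weakly decreasing tuple. -/
def antitoneConsEquiv (m : ℕ) :
    (Σ k : ℕ, antitoneTuples m k) ≃ {i : Fin (m + 1) → ℕ // Antitone i} where
  toFun x := ⟨Fin.cons x.1 x.2.1, antitone_cons_iff.mpr x.2.2⟩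
  invFun i := ⟨i.1 0, Fin.tail i.1, antitone_cons_iff.mp ((Fin.cons_self_tail i.1).symm ▸ i.2)⟩
  left_inv _ := rfl
  right_inv i := Subtype.ext (Fin.cons_self_tail i.1)

theorem cons_mem_antitoneTuples {m j k : ℕ} {i : Fin m → ℕ} :
    (Fin.cons j i : Fin (m + 1) → ℕ) ∈ antitoneTuples (m + 1) k ↔
      j ≤ k ∧ i ∈ antitoneTuples m j := by
  rw [mem_antitoneTuples, antitone_cons_iff, and_congr_left_iff]
  exact fun hi => ⟨fun h => h 0, fun h => Fin.cases h fun n =>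
    ((mem_antitoneTuples.mp hi).1 n).trans h⟩

theorem sum_antitoneTuples_succ {M : Type*} [AddCommMonoid M] (m k : ℕ)
    (f : (Fin (m + 1) → ℕ) → M) :
    ∑ i ∈ antitoneTuples (m + 1) k, f i =
      ∑ j ∈ Finset.range (k + 1), ∑ i ∈ antitoneTuples m j, f (Fin.cons j i) := by
  rw [Finset.sum_sigma']
  refine Finset.sum_nbij' (fun i => ⟨i 0, Fin.tail i⟩) (fun x => Fin.cons x.1 x.2)
    (fun i hi => ?_) (fun x hx => ?_) (fun i _ => Fin.cons_self_tail i) (fun _ _ => rfl)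
    (fun i _ => congrArg f (Fin.cons_self_tail i).symm)
  · rw [← Fin.cons_self_tail i, cons_mem_antitoneTuples] at hi
    exact Finset.mem_sigma.mpr ⟨Finset.mem_range_succ_iff.mpr hi.1, hi.2⟩
  · obtain ⟨hle, hmem⟩ := Finset.mem_sigma.mp hx
    exact cons_mem_antitoneTuples.mpr ⟨Finset.mem_range_succ_iff.mp hle, hmem⟩

theorem sum_antitoneTuples_prod {K : Type*} [CommRing K] (g : ℕ → ℕ → K) (m k : ℕ) :
    ∑ i ∈ antitoneTuples m k, ∏ n, g (n.rev : ℕ) (i n) = nestedSum g k m := by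
  induction m generalizing k with
  | zero =>
    have huniv : antitoneTuples 0 k = Finset.univ := Finset.eq_univ_iff_forall.mpr fun _ =>
      mem_antitoneTuples.mpr ⟨fun n => n.elim0, fun n => n.elim0⟩
    simp [huniv, nestedSum_zero]
  | succ m ih =>
    rw [sum_antitoneTuples_succ, nestedSum_succ]
    refine Finset.sum_congr rfl fun j _ => ?_
    simp only [← ih, Finset.mul_sum, Fin.prod_univ_succ, Fin.cons_zero, Fin.cons_succ, Fin.rev_zero,
      Fin.val_last, Fin.rev_succ, Fin.val_castSucc]

end AntitoneTuples

section Li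

variable {F : Type*} [Field F] [Fintype F] {K : Type*} [NormedField K] [Algebra F K] {θ : K} {r : ℕ}
  {s : Fin r → ℕ} {u : Fin r → K}

theorem rhoPoint_eq (a : F[X]) :
    rhoPoint F θ s u a =
      aeval (TwistedSeries.linearAction F
        (Matrix.scalar (Idx (s ∘ Fin.rev)) θ + matN (s ∘ Fin.rev))
        (matE (s ∘ Fin.rev) (u ∘ Fin.rev))) a (specialPoint (s ∘ Fin.rev) (u ∘ Fin.rev)) :=
  TwistedSeries.eval_aeval_linear _ _ _ _

theorem rhoPoint_one : rhoPoint F θ s u 1 = specialPoint (s ∘ Fin.rev) (u ∘ Fin.rev) := by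
  rw [rhoPoint_eq, map_one, Module.End.one_apply]

theorem isAlgebraic_rhoPoint {k : Type*} [Field k] [Algebra F k] [Algebra k K]
    [IsScalarTower F k K] (hθ : IsAlgebraic k θ) (hu : ∀ i, IsAlgebraic k (u i)) (a : F[X])
    (x : Idx (s ∘ Fin.rev)) : IsAlgebraic k (rhoPoint F θ s u a x) := by
  let S : Subalgebra F K := (algebraicClosure k K).toSubalgebra.restrictScalars F
  have mem_S {y : K} : y ∈ S ↔ IsAlgebraic k y := mem_algebraicClosure_iff
  have hu_mem (i : Fin r) : (u ∘ Fin.rev) i ∈ S := mem_S.mpr (hu i.rev)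
  rw [← mem_S, rhoPoint_eq]
  exact TwistedSeries.aeval_linearAction_apply_mem S
    (scalar_add_matN_apply_mem S (mem_S.mpr hθ)) (matE_apply_mem S hu_mem) a
    (specialPoint_apply_mem S hu_mem) x

theorem isAdmissible_one (hr : 0 < r) (hu : ∀ i, ‖u i‖ ≤ 1) (hu₀ : ‖u ⟨0, hr⟩‖ < 1) :
    IsAdmissible F θ s u 1 := by
  refine ⟨one_ne_zero, fun x => ?_⟩
  rw [rhoPoint_one, specialPoint]
  split_ifs
  · have hmem : Fin.rev ⟨0, hr⟩ ∈ Finset.Ici x.1 :=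
      Finset.mem_Ici.mpr (Fin.le_rev_iff.mpr (Fin.mk_le_of_le_val (Nat.zero_le _)))
    rw [norm_mul, norm_pow, norm_neg, norm_one, one_pow, one_mul, norm_prod,
      ← Finset.mul_prod_erase _ _ hmem, Function.comp_apply, Fin.rev_rev]
    exact mul_lt_one_of_nonneg_of_lt_one_left (norm_nonneg _) hu₀
      (Finset.prod_le_one (fun _ _ => norm_nonneg _) fun i _ => hu i.rev)
  · exact norm_zero.trans_lt one_pos

theorem Li_of_depth_eq_zero (hr : r = 0) : Li F θ s u = 0 := by
  subst hr
  rw [Li]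
  split_ifs
  · rw [lastOfFirstBlock, dif_neg fun h => h.1.false, mul_zero]
  · rfl

theorem logRow_dotProduct_specialPoint (hθ : ∀ n ≠ 0, θ ^ Fintype.card F ^ n ≠ θ) (hr : 0 < r)
    (hd : ∀ l, 0 < blockDim s l) (k : ℕ) :
    logRow F θ u hr hd k ⬝ᵥ TwistedSeries.twistVec F k (specialPoint s u) =
      (-1) ^ (r - 1) *
        (liFactor F θ s u (r - 1) k * nestedSum (liFactor F θ s u) k (r - 1)) := by
  have hterm (m : Fin r) : logRow F θ u hr hd k (lastIdx hd m) * ((-1) ^ (r - 1 - (m : ℕ)) *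
      ∏ e ∈ Finset.Ico (m : ℕ) r, entry u (e + 1) ^ Fintype.card F ^ k) =
      (-1) ^ (r - 1) * (strictNestedSum (liFactor F θ s u) k m *
        ∏ e ∈ Finset.Ico (m : ℕ) r, liFactor F θ s u e k) := by
    have hlast := logRow_apply (u := u) hθ hr hd k m (lastIdx hd m).2
    rw [val_rev_lastIdx_snd, pow_zero, mul_one] at hlast
    have hsign : (-1 : K) ^ (r - 1) = (-1) ^ (m : ℕ) * (-1) ^ (r - 1 - (m : ℕ)) := by
      rw [← pow_add, Nat.add_sub_cancel' (Nat.le_sub_one_of_lt m.2)]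
    rw [prod_Ico_liFactor, ← blockDim_eq_sum_entry, hsign]
    exact (congrArg (· * _) hlast).trans (by ring)
  rw [dotProduct_twistVec_specialPoint hd, Finset.sum_congr rfl fun m _ => hterm m,
    ← Finset.mul_sum, mul_nestedSum_eq_sum, Nat.sub_add_cancel hr,
    Finset.sum_range (n := r)]

variable [IsUltrametricDist K] [CompleteSpace K]

theorem rowEval_logRow_rhoPoint_mul (hθ : IsIntegralTheta F θ) (hr : 0 < r)
    (hd : ∀ l, 0 < blockDim (s ∘ Fin.rev) l) (hu : ∀ i, ‖u i‖ ≤ 1) (a : F[X]) {b : F[X]}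
    (hb : ∀ x, ‖rhoPoint F θ s u b x‖ < 1) :
    TwistedSeries.rowEval F (logRow F θ (u ∘ Fin.rev) hr hd) (rhoPoint F θ s u (a * b)) =
      aeval θ a *
        TwistedSeries.rowEval F (logRow F θ (u ∘ Fin.rev) hr hd) (rhoPoint F θ s u b) := by
  have hu' (i : Fin r) : ‖(u ∘ Fin.rev) i‖ ≤ 1 := hu i.rev
  have h := TwistedSeries.rowEval_aeval_linearAction (exists_norm_logRow_le hθ hr hd hu')
    (isEigenrow_logRow hθ.pow_ne hr hd)
    (scalar_add_matN_apply_mem (closedUnitBall F K) hθ.norm_le_one)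
    (matE_apply_mem (closedUnitBall F K) hu') a (mem_polydisc.mpr hb)
  rwa [rhoPoint_eq b, ← Module.End.mul_apply, ← map_mul, ← rhoPoint_eq, ← rhoPoint_eq] at h

theorem Li_eq_of_isAdmissible (hθ : IsIntegralTheta F θ) (hr : 0 < r)
    (hd : ∀ l, 0 < blockDim (s ∘ Fin.rev) l) (hu : ∀ i, ‖u i‖ ≤ 1) {a : F[X]}
    (ha : IsAdmissible F θ s u a) :
    Li F θ s u = (-1) ^ (r - 1) / aeval θ a *
      TwistedSeries.rowEval F (logRow F θ (u ∘ Fin.rev) hr hd) (rhoPoint F θ s u a) := by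
  have hex : ∃ a : F[X], IsAdmissible F θ s u a := ⟨a, ha⟩
  rw [Li, dif_pos hex, lastOfFirstBlock_eval_log hr hd]
  have hb := hex.choose_spec
  set b := hex.choose
  have hab := rowEval_logRow_rhoPoint_mul hθ hr hd hu a hb.2
  rw [mul_comm, rowEval_logRow_rhoPoint_mul hθ hr hd hu b ha.2] at hab
  rw [div_mul_eq_mul_div, div_mul_eq_mul_div,
    div_eq_div_iff (hθ.aeval_ne_zero hb.1) (hθ.aeval_ne_zero ha.1)]
  linear_combination -(-1) ^ (r - 1) * hab

theorem hasSum_nestedSum_Li (hθ : IsIntegralTheta F θ) (hr : 0 < r) (hs : 0 < s ⟨0, hr⟩)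
    (hu : ∀ i, ‖u i‖ ≤ 1) (hu₀ : ‖u ⟨0, hr⟩‖ < 1) :
    HasSum (fun k => liFactor F θ (s ∘ Fin.rev) (u ∘ Fin.rev) (r - 1) k *
      nestedSum (liFactor F θ (s ∘ Fin.rev) (u ∘ Fin.rev)) k (r - 1)) (Li F θ s u) := by
  have hd := blockDim_comp_rev_pos hr hs
  have hadm : IsAdmissible F θ s u 1 := isAdmissible_one hr hu hu₀
  have hsum := (TwistedSeries.summable_dotProduct_twistVec (F := F)
    (exists_norm_logRow_le hθ hr hd (u := u ∘ Fin.rev) fun i => hu i.rev)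
    (mem_polydisc.mpr hadm.2)).hasSum.mul_left ((-1 : K) ^ (r - 1))
  rw [Li_eq_of_isAdmissible hθ hr hd hu hadm, map_one, div_one, TwistedSeries.rowEval]
  simpa only [rhoPoint_one, logRow_dotProduct_specialPoint hθ.pow_ne, ← mul_assoc,
    ← mul_pow, neg_one_mul, neg_neg, one_pow, one_mul] using hsum

end Li

section PowerSeries

variable {F : Type*} [Fintype F] {K : Type*} [NormedField K] {θ : K}

theorem liFactor_rev {r : ℕ} (s : Fin r → ℕ) (u : Fin r → K) (e : Fin r) (k : ℕ) :
    liFactor F θ (s ∘ Fin.rev) (u ∘ Fin.rev) e.rev k =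
      u e ^ Fintype.card F ^ k / bigL F θ k ^ s e := by
  rw [liFactor, entry_val_add_one, entry_val_add_one, Function.comp_apply, Function.comp_apply,
    Fin.rev_rev]

variable {n : ℕ} {s : Fin (n + 1) → ℕ} {u : Fin (n + 1) → K}

theorem sum_liTerm_cons (k : ℕ) :
    ∑ i : antitoneTuples n k, liTerm F θ s u (antitoneConsEquiv n ⟨k, i⟩) =
      liFactor F θ (s ∘ Fin.rev) (u ∘ Fin.rev) n k *
        nestedSum (liFactor F θ (s ∘ Fin.rev) (u ∘ Fin.rev)) k n := by
  rw [← sum_antitoneTuples_prod, Finset.mul_sum, ← Finset.sum_coe_sort (antitoneTuples n k)]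
  refine Finset.sum_congr rfl fun i _ => ?_
  have hterm : liTerm F θ s u (antitoneConsEquiv n ⟨k, i⟩) =
      ∏ e : Fin (n + 1), liFactor F θ (s ∘ Fin.rev) (u ∘ Fin.rev) e.rev
        ((Fin.cons k i.1 : Fin (n + 1) → ℕ) e) :=
    Finset.prod_congr rfl fun e _ => (liFactor_rev s u e _).symm
  rw [hterm, Fin.prod_univ_succ]
  simp only [Fin.cons_zero, Fin.cons_succ, Fin.rev_zero, Fin.val_last, Fin.rev_succ,
    Fin.val_castSucc]

theorem norm_liTerm_le {b : ℝ} (hb : 1 ≤ b) (hL : ∀ k, ‖(bigL F θ k)⁻¹‖ ≤ b ^ k)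
    (hu : ∀ i, ‖u i‖ ≤ 1) (i : {i : Fin (n + 1) → ℕ // Antitone i}) :
    ‖liTerm F θ s u i‖ ≤ (b ^ ∑ e, s e) ^ i.1 0 * ‖u 0‖ ^ Fintype.card F ^ i.1 0 := by
  have : 0 ≤ b := zero_le_one.trans hb
  have hfirst : ‖u 0 ^ Fintype.card F ^ i.1 0 / bigL F θ (i.1 0) ^ s 0‖ ≤
      ‖u 0‖ ^ Fintype.card F ^ i.1 0 * (b ^ i.1 0) ^ s 0 := by
    rw [div_eq_mul_inv, ← inv_pow, norm_mul, norm_pow, norm_pow]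
    gcongr
    exact hL _
  have hrest (e : Fin n) :
      ‖u e.succ ^ Fintype.card F ^ i.1 e.succ / bigL F θ (i.1 e.succ) ^ s e.succ‖ ≤
        (b ^ i.1 0) ^ s e.succ := by
    refine (norm_pow_div_bigL_pow_le hL (hu _) _ _).trans ?_
    gcongr
    exact i.2 (Fin.zero_le _)
  calc ‖liTerm F θ s u i‖
      ≤ ‖u 0‖ ^ Fintype.card F ^ i.1 0 * (b ^ i.1 0) ^ s 0 *
          ∏ e : Fin n, (b ^ i.1 0) ^ s e.succ := by
        rw [liTerm, norm_prod, Fin.prod_univ_succ]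
        gcongr
        exact hrest _
    _ = (b ^ ∑ e, s e) ^ i.1 0 * ‖u 0‖ ^ Fintype.card F ^ i.1 0 := by
        rw [Finset.prod_pow_eq_pow_sum, Fin.sum_univ_succ, mul_assoc, ← pow_add, pow_right_comm,
          mul_comm]

theorem summable_liTerm_cons [Nontrivial F] [IsUltrametricDist K] [CompleteSpace K]
    (hθ : IsIntegralTheta F θ) (hu : ∀ i, ‖u i‖ ≤ 1) (hu₀ : ‖u 0‖ < 1) :
    Summable fun x => liTerm F θ s u (antitoneConsEquiv n x) := by
  obtain ⟨b, hb, hL⟩ := hθ.exists_norm_inv_bigL_le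
  have hfst : Tendsto (Sigma.fst : (Σ k : ℕ, antitoneTuples n k) → ℕ) cofinite cofinite := by
    refine Tendsto.cofinite_of_finite_preimage_singleton fun k => ?_
    refine (Set.finite_range fun i : antitoneTuples n k => Sigma.mk k i).subset ?_
    rintro ⟨k, i⟩ rfl
    exact ⟨i, rfl⟩
  have hlim := tendsto_pow_mul_pow_pow_atTop (B := b ^ ∑ e, s e)
    (pow_nonneg (zero_le_one.trans hb) _) (norm_nonneg (u 0)) hu₀ (Fintype.one_lt_card (α := F))
  rw [← Nat.cofinite_eq_atTop] at hlim
  exact NonarchimedeanAddGroup.summable_of_tendsto_cofinite_zero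
    (squeeze_zero_norm (fun _ => norm_liTerm_le hb hL hu _) (hlim.comp hfst))

end PowerSeries

theorem hasSum_liTerm {F : Type*} [Field F] [Fintype F] {K : Type*} [NormedField K]
    [IsUltrametricDist K] [CompleteSpace K] [Algebra F K] {θ : K} (hθ : IsIntegralTheta F θ)
    {r : ℕ} (hr : 0 < r) {s : Fin r → ℕ} (hs : 0 < s ⟨0, hr⟩) {u : Fin r → K}
    (hu : ∀ i, ‖u i‖ ≤ 1) (hu₀ : ‖u ⟨0, hr⟩‖ < 1) :
    HasSum (liTerm F θ s u) (Li F θ s u) := by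
  obtain ⟨n, rfl⟩ := Nat.exists_eq_succ_of_ne_zero hr.ne'
  rw [← (antitoneConsEquiv n).hasSum_iff]
  refine HasSum.sigma_of_hasSum (hasSum_nestedSum_Li hθ hr hs hu hu₀) (fun k => ?_)
    (summable_liTerm_cons hθ hu hu₀)
  have hfib := hasSum_fintype fun i : antitoneTuples n k =>
    liTerm F θ s u (antitoneConsEquiv n ⟨k, i⟩)
  rwa [sum_liTerm_cons] at hfib

section Merged

theorem sum_entry_eq_sum_entry_rev {r : ℕ} (s : Fin r → ℕ) {i : ℕ} (hi : i ≤ r) :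
    ∑ e ∈ Finset.Icc 1 i, entry s e =
      ∑ e ∈ Finset.Ico (r - i) r, entry (s ∘ Fin.rev) (e + 1) := by
  refine Finset.sum_nbij' (r - ·) (r - ·) ?_ ?_ ?_ ?_ fun e he => ?_
  case refine_5 =>
    rw [Finset.mem_Icc] at he
    rw [entry_comp_rev s (by omega), Nat.sub_sub_self (he.2.trans hi)]
  all_goals
    intro e he
    simp only [Finset.mem_Icc, Finset.mem_Ico] at he ⊢
    omega

theorem merged_zero_pos {r : ℕ} (hr : 0 < r) {s : Fin r → ℕ} (hs : 0 < s ⟨0, hr⟩) {i : ℕ}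
    (hi : 1 ≤ i) (h : 0 < r + 1 - i) : 0 < merged s i ⟨0, h⟩ := by
  have hentry : entry s 1 = s ⟨0, hr⟩ := entry_val_add_one s ⟨0, hr⟩
  rw [← hentry] at hs
  exact hs.trans_le <| Finset.single_le_sum (f := entry s) (fun _ _ => Nat.zero_le _)
    (Finset.mem_Icc.mpr ⟨le_rfl, hi⟩)

theorem entry_merged_rev {r : ℕ} (s : Fin r → ℕ) {i e : ℕ} (he : e < r - i) :
    entry (merged s i ∘ Fin.rev) (e + 1) = entry (s ∘ Fin.rev) (e + 1) := by
  rw [entry_comp_rev _ (by omega), entry_comp_rev _ (by omega), entry, dif_pos (by omega),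
    merged, if_neg (by dsimp only; omega)]
  congr 1
  dsimp only
  omega

theorem entry_withHead_rev {α : Type*} [Zero α] {r : ℕ} (z : α) (u : Fin r → α) {i e : ℕ}
    (he : e < r - i) :
    entry (withHead z u i ∘ Fin.rev) (e + 1) = entry (u ∘ Fin.rev) (e + 1) := by
  rw [entry_comp_rev _ (by omega), entry_comp_rev _ (by omega), entry, dif_pos (by omega),
    withHead, if_neg (by dsimp only; omega)]
  congr 1
  dsimp only
  omega

theorem norm_withHead_le_one {K : Type*} [NormedField K] {r : ℕ} {z : K} (hz : ‖z‖ ≤ 1)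
    {u : Fin r → K} (hu : ∀ i, ‖u i‖ ≤ 1) (i : ℕ) (n : Fin (r + 1 - i)) :
    ‖withHead z u i n‖ ≤ 1 := by
  rw [withHead]
  split_ifs
  · exact hz
  · exact norm_entry_le_one hu _

theorem norm_pow_mul_lt_one {K : Type*} [NormedField K] {θ z : K} (hθ : ‖θ‖ ≤ 1) (hz : ‖z‖ < 1)
    (n : ℕ) : ‖θ ^ n * z‖ < 1 := by
  rw [norm_mul, norm_pow]
  exact mul_lt_one_of_nonneg_of_lt_one_right (pow_le_one₀ (norm_nonneg _) hθ) (norm_nonneg _) hz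

theorem norm_mul_entry_lt_one {K : Type*} [NormedField K] {r : ℕ} {u : Fin r → K}
    (hu : ∀ i, ‖u i‖ ≤ 1) {z : K} (hz : ‖z‖ < 1) (e : ℕ) : ‖z * entry u e‖ < 1 := by
  rw [norm_mul]
  exact mul_lt_one_of_nonneg_of_lt_one_left (norm_nonneg _) hz (norm_entry_le_one hu e)

variable {F : Type*} [Field F] [Fintype F] {K : Type*} [NormedField K] {θ : K} {r : ℕ}
  {s : Fin r → ℕ} {u : Fin r → K}

theorem logRow_rev_mul_pow [Algebra F K] (hθ : ∀ n ≠ 0, θ ^ Fintype.card F ^ n ≠ θ) (hr : 0 < r)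
    (hd : ∀ l, 0 < blockDim s l) (m : Fin r) (j : Fin (blockDim s m)) (z : K) (k : ℕ) :
    logRow F θ u hr hd k ⟨m, j.rev⟩ * z ^ Fintype.card F ^ k =
      ∑ l ∈ Finset.range ((j : ℕ) + 1),
        (-1) ^ ((j : ℕ) + l + m) * (Nat.choose j l : K) * θ ^ l *
          ((θ ^ ((j : ℕ) - l) * z) ^ Fintype.card F ^ k / bigL F θ k ^ blockDim s m *
            strictNestedSum (liFactor F θ s u) k m) := by
  rw [logRow_apply hθ, Fin.rev_rev, sub_eq_add_neg, add_pow, Finset.mul_sum, Finset.sum_div,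
    Finset.sum_mul, Finset.sum_mul]
  refine Finset.sum_congr rfl fun l hl => ?_
  have hlj : l ≤ j := Finset.mem_range_succ_iff.mp hl
  have hsign : (-1 : K) ^ ((j : ℕ) + l + m) = (-1) ^ ((j : ℕ) - l) * (-1) ^ (m : ℕ) := by
    rw [← pow_add, show (j : ℕ) + l + m = (j : ℕ) - l + m + 2 * l by omega,
      pow_add _ _ (2 * l), pow_mul, neg_one_sq, one_pow, mul_one]
  rw [hsign, mul_pow, neg_pow (θ ^ Fintype.card F ^ k), pow_right_comm θ]
  ring

variable [Algebra F K] [IsUltrametricDist K] [CompleteSpace K]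

theorem hasSum_liTerm_merged (hθ : IsIntegralTheta F θ) (hr : 0 < r) (hs : 0 < s ⟨0, hr⟩)
    (hu : ∀ i, ‖u i‖ ≤ 1) {i : ℕ} (hi : 1 ≤ i) (hir : i ≤ r) {z : K} (hz : ‖z‖ < 1) :
    HasSum (liTerm F θ (merged s i) (withHead z u i)) (Li F θ (merged s i) (withHead z u i)) :=
  hasSum_liTerm hθ (Nat.sub_pos_of_lt (Nat.lt_succ_of_le hir)) (merged_zero_pos hr hs hi _)
    (norm_withHead_le_one hz.le hu i) hz

theorem hasSum_nestedSum_Li_merged (hθ : IsIntegralTheta F θ) (hr : 0 < r) (hs : 0 < s ⟨0, hr⟩)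
    (hu : ∀ i, ‖u i‖ ≤ 1) {i : ℕ} (hi : 1 ≤ i) (hir : i ≤ r) {z : K} (hz : ‖z‖ < 1) :
    HasSum (fun k => z ^ Fintype.card F ^ k /
      bigL F θ k ^ (∑ e ∈ Finset.Ico (r - i) r, entry (s ∘ Fin.rev) (e + 1)) *
        nestedSum (liFactor F θ (s ∘ Fin.rev) (u ∘ Fin.rev)) k (r - i))
      (Li F θ (merged s i) (withHead z u i)) := by
  have hR : 0 < r + 1 - i := Nat.sub_pos_of_lt (Nat.lt_succ_of_le hir)
  have hsum := hasSum_nestedSum_Li hθ hR (merged_zero_pos hr hs hi hR)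
    (norm_withHead_le_one hz.le hu i) hz
  have htail : ∀ e < r - i, liFactor F θ (merged s i ∘ Fin.rev) (withHead z u i ∘ Fin.rev) e =
      liFactor F θ (s ∘ Fin.rev) (u ∘ Fin.rev) e := fun e he => by
    funext k
    rw [liFactor, liFactor, entry_merged_rev s he, entry_withHead_rev z u he]
  have hhead (k : ℕ) : liFactor F θ (merged s i ∘ Fin.rev) (withHead z u i ∘ Fin.rev)
      (r + 1 - i - 1) k = z ^ Fintype.card F ^ k /
        bigL F θ k ^ (∑ e ∈ Finset.Ico (r - i) r, entry (s ∘ Fin.rev) (e + 1)) := by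
    rw [← sum_entry_eq_sum_entry_rev s hir]
    exact liFactor_rev (merged s i) (withHead z u i) ⟨0, hR⟩ k
  simp only [hhead] at hsum
  simpa only [Nat.succ_sub hir, Nat.succ_sub_one, nestedSum_congr htail] using hsum

theorem hasSum_Li_sub_Li (hθ : IsIntegralTheta F θ) (hr : 0 < r) (hs : 0 < s ⟨0, hr⟩)
    (hu : ∀ i, ‖u i‖ ≤ 1) (m : Fin r) {z : K} (hz : ‖z‖ < 1) :
    HasSum (fun k => z ^ Fintype.card F ^ k / bigL F θ k ^ blockDim (s ∘ Fin.rev) m *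
        strictNestedSum (liFactor F θ (s ∘ Fin.rev) (u ∘ Fin.rev)) k m)
      (Li F θ (merged s (r - m)) (withHead z u (r - m)) -
        Li F θ (merged s (r + 1 - m)) (withHead (z * entry u (r + 1 - m)) u (r + 1 - m))) := by
  obtain ⟨m, hm⟩ := m
  have hsum := hasSum_nestedSum_Li_merged hθ hr hs hu (i := r - m) (by omega) (by omega) hz
  rw [Nat.sub_sub_self hm.le] at hsum
  rw [blockDim_eq_sum_entry]
  cases m with
  | zero =>
    rw [Li_of_depth_eq_zero (s := merged s (r + 1 - 0)) (Nat.sub_self _), sub_zero]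
    simpa only [strictNestedSum_zero, nestedSum_zero] using hsum
  | succ m =>
    have hsub : r - (r + 1 - (m + 1)) = m := by omega
    have hentry : entry (u ∘ Fin.rev) (m + 1) = entry u (r + 1 - (m + 1)) := by
      rw [entry_comp_rev u (Nat.lt_of_succ_lt hm), Nat.succ_sub_succ]
    have hsum' := hasSum_nestedSum_Li_merged hθ hr hs hu (i := r + 1 - (m + 1)) (by omega)
      (by omega) (norm_mul_entry_lt_one hu hz (r + 1 - (m + 1)))
    rw [hsub, Finset.sum_eq_sum_Ico_succ_bot (Nat.lt_of_succ_lt hm)] at hsum'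
    refine (hsum.sub hsum').congr_fun fun k => ?_
    rw [nestedSum_succ_eq_add, liFactor, hentry, mul_pow, pow_add, mul_div_mul_comm]
    ring

theorem hasSum_logRow_mul_pow (hθ : IsIntegralTheta F θ) (hr : 0 < r) (hs : 0 < s ⟨0, hr⟩)
    (hd : ∀ l, 0 < blockDim (s ∘ Fin.rev) l) (hu : ∀ i, ‖u i‖ ≤ 1) (m : Fin r)
    (j : Fin (blockDim (s ∘ Fin.rev) m)) {z : K} (hz : ‖z‖ < 1) :
    HasSum (fun k => logRow F θ (u ∘ Fin.rev) hr hd k ⟨m, j.rev⟩ * z ^ Fintype.card F ^ k)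
      (∑ l ∈ Finset.range ((j : ℕ) + 1),
        (-1) ^ ((j : ℕ) + l + m) * (Nat.choose j l : K) * θ ^ l *
          (Li F θ (merged s (r - m)) (withHead (θ ^ ((j : ℕ) - l) * z) u (r - m)) -
            Li F θ (merged s (r + 1 - m))
              (withHead (θ ^ ((j : ℕ) - l) * z * entry u (r + 1 - m)) u (r + 1 - m)))) := by
  simp only [logRow_rev_mul_pow hθ.pow_ne]
  exact hasSum_sum fun l _ =>
    (hasSum_Li_sub_Li hθ hr hs hu m (norm_pow_mul_lt_one hθ.norm_le_one hz _)).mul_left _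

theorem rowEval_logRow_eq_sum (hθ : IsIntegralTheta F θ) (hr : 0 < r) (hs : 0 < s ⟨0, hr⟩)
    (hd : ∀ l, 0 < blockDim (s ∘ Fin.rev) l) (hu : ∀ i, ‖u i‖ ≤ 1)
    {V : Idx (s ∘ Fin.rev) → K} (hV : ∀ x, ‖V x‖ < 1) :
    TwistedSeries.rowEval F (logRow F θ (u ∘ Fin.rev) hr hd) V =
      ∑ m : Fin r, ∑ j : Fin (blockDim (s ∘ Fin.rev) m), ∑ l ∈ Finset.range ((j : ℕ) + 1),
        (-1) ^ ((j : ℕ) + l + m) * (Nat.choose j l : K) * θ ^ l *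
          (Li F θ (merged s (r - m)) (withHead (θ ^ ((j : ℕ) - l) * V ⟨m, j.rev⟩) u (r - m)) -
            Li F θ (merged s (r + 1 - m))
              (withHead (θ ^ ((j : ℕ) - l) * V ⟨m, j.rev⟩ * entry u (r + 1 - m)) u
                (r + 1 - m))) := by
  have hsum := hasSum_sum (s := Finset.univ) fun m _ =>
    hasSum_sum (s := Finset.univ) fun j _ =>
      hasSum_logRow_mul_pow hθ hr hs hd hu m j (hV ⟨m, j.rev⟩)
  rw [← hsum.tsum_eq, TwistedSeries.rowEval]
  refine tsum_congr fun k => ?_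
  simp only [dotProduct, TwistedSeries.twistVec_apply, Fintype.sum_sigma]
  refine Finset.sum_congr rfl fun m _ => ?_
  exact (Equiv.sum_comp Fin.revPerm fun j => logRow F θ (u ∘ Fin.rev) hr hd k ⟨m, j⟩ *
    V ⟨m, j⟩ ^ Fintype.card F ^ k).symm

end Merged

end CMSPL

theorem squarefree_X_sub_X_pow_card_pow (F : Type*) [Field F] [Fintype F] {n : ℕ} (hn : n ≠ 0) :
    Squarefree (X - X ^ Fintype.card F ^ n : F[X]) := by
  obtain ⟨p, _⟩ := CharP.exists F
  have hp : p ∣ Fintype.card F :=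
    (CharP.cast_eq_zero_iff F p _).mp (FiniteField.cast_card_eq_zero F)
  exact fun g hg =>
    (galois_poly_separable p _ (dvd_pow hp hn)).squarefree g (dvd_sub_comm.mp hg)

theorem notMem_sq_of_squarefree {R : Type*} [CommRing R] [IsPrincipalIdealRing R] {I : Ideal R}
    (hI : I ≠ ⊤) {x : R} (hx : Squarefree x) : x ∉ I ^ 2 := by
  obtain ⟨g, rfl⟩ := (IsPrincipalIdealRing.principal I).principal
  intro h
  rw [Ideal.submodule_span_eq, Ideal.span_singleton_pow, Ideal.mem_span_singleton, sq] at h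
  exact hI (Ideal.span_singleton_eq_top.mpr (hx g h))

namespace FunctionFieldPlace

variable {F : Type*} [Field F] [Fintype F] (v : HeightOneSpectrum F[X])

instance isUltrametricDistCv : IsUltrametricDist (Cv v) := by
  refine IsUltrametricDist.isUltrametricDist_of_isNonarchimedean_norm fun x y => ?_
  refine UniformSpace.Completion.induction_on₂ (p := fun x y : UniformSpace.Completion (KvBar v) =>
    ‖x + y‖ ≤ max ‖x‖ ‖y‖) x y (isClosed_le (by fun_prop) (by fun_prop)) fun a b => ?_
  rw [← UniformSpace.Completion.coe_add, UniformSpace.Completion.norm_coe,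
    UniformSpace.Completion.norm_coe, UniformSpace.Completion.norm_coe]
  exact isNonarchimedean_spectralNorm (K := Kv v) (L := KvBar v) a b

instance isScalarTower_Cv : IsScalarTower F (RatFunc F) (Cv v) :=
  IsScalarTower.of_algebraMap_eq' rfl

theorem norm_algebraMap_Cv (x : RatFunc F) :
    ‖algebraMap (RatFunc F) (Cv v) x‖ = ‖algebraMap (RatFunc F) (Kv v) x‖ := by
  change ‖((algebraMap (Kv v) (KvBar v) (algebraMap (RatFunc F) (Kv v) x) : KvBar v) :
    UniformSpace.Completion (KvBar v))‖ = _
  rw [UniformSpace.Completion.norm_coe]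
  exact spectralNorm_extends (L := KvBar v) (algebraMap (RatFunc F) (Kv v) x)

theorem norm_algebraMap_Cv_le_iff (x y : RatFunc F) :
    ‖algebraMap (RatFunc F) (Cv v) x‖ ≤ ‖algebraMap (RatFunc F) (Cv v) y‖ ↔
      v.valuation (RatFunc F) x ≤ v.valuation (RatFunc F) y := by
  rw [norm_algebraMap_Cv, norm_algebraMap_Cv, Valued.toNormedField.norm_le_iff,
    ← v.valuedAdicCompletion_eq_valuation' x, ← v.valuedAdicCompletion_eq_valuation' y]
  rfl

theorem norm_theta_le_one : ‖theta v‖ ≤ 1 := by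
  have h := (norm_algebraMap_Cv_le_iff v RatFunc.X 1).mpr
  rw [map_one, map_one, norm_one, ← RatFunc.algebraMap_X] at h
  exact h (v.valuation_le_one X)

theorem exists_le_norm_theta_sub :
    ∃ c : ℝ, 0 < c ∧ ∀ n ≠ 0, c ≤ ‖theta v - theta v ^ Fintype.card F ^ n‖ := by
  obtain ⟨π, hπ⟩ := v.valuation_exists_uniformizer (RatFunc F)
  have hπ₀ : π ≠ 0 := by
    rintro rfl
    rw [map_zero] at hπ
    exact WithZero.exp_ne_zero hπ.symm
  refine ⟨‖algebraMap (RatFunc F) (Cv v) (π ^ 2)‖,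
    norm_pos_iff.mpr ((_root_.map_ne_zero _).mpr (pow_ne_zero 2 hπ₀)), fun n hn => ?_⟩
  have htheta : theta v - theta v ^ Fintype.card F ^ n = algebraMap (RatFunc F) (Cv v)
      (algebraMap F[X] (RatFunc F) (X - X ^ Fintype.card F ^ n)) := by
    rw [theta, map_sub, map_pow, RatFunc.algebraMap_X, map_sub, map_pow]
  have hval := mt (v.intValuation_le_pow_iff_mem _ 2).mp
    (notMem_sq_of_squarefree v.isPrime.ne_top (squarefree_X_sub_X_pow_card_pow F hn))
  rw [htheta, norm_algebraMap_Cv_le_iff, v.valuation_of_algebraMap, map_pow, hπ]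
  refine le_trans (le_of_eq ?_) (not_le.mp hval).le
  rw [← WithZero.exp_nsmul]
  rfl

theorem isIntegralTheta_theta : CMSPL.IsIntegralTheta F (theta v) :=
  ⟨norm_theta_le_one v, exists_le_norm_theta_sub v⟩

end FunctionFieldPlace

open CMSPL in
theorem theorem3_general {F : Type*} [Field F] [Fintype F] {k : Type*} [Field k] [Algebra F k]
    {K : Type*} [NormedField K] [IsUltrametricDist K] [CompleteSpace K] [Algebra F K]
    [Algebra k K] [IsScalarTower F k K] {θ : K} (hθ : IsIntegralTheta F θ)
    (hθ_alg : IsAlgebraic k θ) {r : ℕ} (hr : 0 < r) {s : Fin r → ℕ} (hs : 0 < s ⟨0, hr⟩)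
    {u : Fin r → K} (hu_alg : ∀ i, IsAlgebraic k (u i)) (hu_le : ∀ i, ‖u i‖ ≤ 1)
    {a : F[X]} (ha : a ≠ 0) {V : Idx (s ∘ Fin.rev) → K} (hV : V = rhoPoint F θ s u a)
    (hV_lt : ∀ x, ‖V x‖ < 1) :
    (∀ x, IsAlgebraic k (V x)) ∧
    (∀ (m : Fin r) (j : Fin (blockDim (s ∘ Fin.rev) m)) (l : ℕ), l ≤ j →
      ‖θ ^ ((j : ℕ) - l) * V ⟨m, j.rev⟩‖ < 1 ∧
      HasSum
        (liTerm F θ (merged s (r - m)) (withHead (θ ^ ((j : ℕ) - l) * V ⟨m, j.rev⟩) u (r - m)))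
        (Li F θ (merged s (r - m)) (withHead (θ ^ ((j : ℕ) - l) * V ⟨m, j.rev⟩) u (r - m))) ∧
      (0 < (m : ℕ) →
        ‖θ ^ ((j : ℕ) - l) * V ⟨m, j.rev⟩ * entry u (r + 1 - m)‖ < 1 ∧
        HasSum
          (liTerm F θ (merged s (r + 1 - m))
            (withHead (θ ^ ((j : ℕ) - l) * V ⟨m, j.rev⟩ * entry u (r + 1 - m)) u (r + 1 - m)))
          (Li F θ (merged s (r + 1 - m))
            (withHead (θ ^ ((j : ℕ) - l) * V ⟨m, j.rev⟩ * entry u (r + 1 - m)) u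
              (r + 1 - m))))) ∧
    Li F θ s u =
      (-1) ^ (r - 1) / aeval θ a *
        ∑ m : Fin r, ∑ j : Fin (blockDim (s ∘ Fin.rev) m), ∑ l ∈ Finset.range ((j : ℕ) + 1),
          (-1) ^ ((j : ℕ) + l + m) * (Nat.choose j l : K) * θ ^ l *
            (Li F θ (merged s (r - m))
                (withHead (θ ^ ((j : ℕ) - l) * V ⟨m, j.rev⟩) u (r - m)) -
              Li F θ (merged s (r + 1 - m))
                (withHead (θ ^ ((j : ℕ) - l) * V ⟨m, j.rev⟩ * entry u (r + 1 - m)) u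
                  (r + 1 - m))) := by
  have hd := blockDim_comp_rev_pos hr hs
  subst hV
  refine ⟨isAlgebraic_rhoPoint hθ_alg hu_alg a, fun m j l _ => ?_, ?_⟩
  · have hz := norm_pow_mul_lt_one hθ.norm_le_one (hV_lt ⟨m, j.rev⟩) (j - l)
    have hz' := norm_mul_entry_lt_one hu_le hz (r + 1 - m)
    exact ⟨hz, hasSum_liTerm_merged hθ hr hs hu_le (by omega) (by omega) hz, fun hm =>
      ⟨hz', hasSum_liTerm_merged hθ hr hs hu_le (by omega) (by omega) hz'⟩⟩
  · rw [Li_eq_of_isAdmissible hθ hr hd hu_le ⟨ha, hV_lt⟩,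
      rowEval_logRow_eq_sum hθ hr hs hd hu_le hV_lt]

end

open FunctionFieldPlace CMSPL in
theorem theorem3 {F : Type*} [Field F] [Fintype F] (v : HeightOneSpectrum F[X])
    {r : ℕ} (hr : 0 < r) (s : Fin r → ℕ) (hs : ∀ i, 0 < s i)
    (u : Fin r → Cv v) (hu_alg : ∀ i, IsAlgebraic (RatFunc F) (u i)) (hu_ne : ∀ i, u i ≠ 0)
    (hu_le : ∀ i, ‖u i‖ ≤ 1)
    (a : F[X]) (ha : a ≠ 0)
    (V : Idx (s ∘ Fin.rev) → Cv v) (hV : V = rhoPoint F (theta v) s u a)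
    (hV_lt : ∀ x, ‖V x‖ < 1) :
    (∀ x, IsAlgebraic (RatFunc F) (V x)) ∧
    (∀ (m : Fin r) (j : Fin (blockDim (s ∘ Fin.rev) m)) (l : ℕ), l ≤ j →
      ‖theta v ^ ((j : ℕ) - l) * V ⟨m, j.rev⟩‖ < 1 ∧
      HasSum
        (liTerm F (theta v) (merged s (r - m))
          (withHead (theta v ^ ((j : ℕ) - l) * V ⟨m, j.rev⟩) u (r - m)))
        (Li F (theta v) (merged s (r - m))
          (withHead (theta v ^ ((j : ℕ) - l) * V ⟨m, j.rev⟩) u (r - m))) ∧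
      (0 < (m : ℕ) →
        ‖theta v ^ ((j : ℕ) - l) * V ⟨m, j.rev⟩ * entry u (r + 1 - m)‖ < 1 ∧
        HasSum
          (liTerm F (theta v) (merged s (r + 1 - m))
            (withHead (theta v ^ ((j : ℕ) - l) * V ⟨m, j.rev⟩ * entry u (r + 1 - m)) u
              (r + 1 - m)))
          (Li F (theta v) (merged s (r + 1 - m))
            (withHead (theta v ^ ((j : ℕ) - l) * V ⟨m, j.rev⟩ * entry u (r + 1 - m)) u
              (r + 1 - m))))) ∧
    Li F (theta v) s u =
      (-1) ^ (r - 1) / Polynomial.aeval (theta v) a *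
        ∑ m : Fin r, ∑ j : Fin (blockDim (s ∘ Fin.rev) m), ∑ l ∈ Finset.range ((j : ℕ) + 1),
          (-1) ^ ((j : ℕ) + l + m) * (Nat.choose j l : Cv v) * theta v ^ l *
            (Li F (theta v) (merged s (r - m))
                (withHead (theta v ^ ((j : ℕ) - l) * V ⟨m, j.rev⟩) u (r - m)) -
              Li F (theta v) (merged s (r + 1 - m))
                (withHead (theta v ^ ((j : ℕ) - l) * V ⟨m, j.rev⟩ * entry u (r + 1 - m)) u
                  (r + 1 - m))) := by
  exact theorem3_general (isIntegralTheta_theta v) (isAlgebraic_algebraMap _) hr (hs _) hu_alg hu_le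
    ha hV hV_lt
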